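/- **Setting.** Let $\mathcal D_0$ be a probability distribution on $\mathbb R^m$ with mean zero that is subgaussian with parameter $K$ (i.e. $\mathbb E\,e^{t\langle v,z_0\rangle}\le e^{K^2t^2/2}$ for all unit vectors $v$ and all $t\in\mathbb R$), let $\mu\in\mathbb R^{m\times d}$, and for $\theta\in\mathbb R^d$ let $\mathcal D(\theta)$ be the law of $z_0+\mu\theta$ with $z_0\sim\mathcal D_0$ (a location family). For a loss $\ell(z;\theta)$, let $\mathrm{PR}(\theta)=\mathbb E_{z\sim\mathcal D(\theta)}\ell(z;\theta)$ be the performative risk. Let $\Theta=\{\theta:\|\theta\|_2\le R\}$, let $\theta_{\mathrm{PO}}\in\Theta$ be a minimizer of $\mathrm{PR}$ over $\Theta$, and let $\mathcal Z=\bigcup_{\theta\in\Theta}\operatorname{supp}\mathcal D(\theta)$. Assume: 1. On $\mathbb R^m\times\Theta$, $\ell$ is $L_z$-Lipschitz in $z$, $L$-Lipschitz in $\theta$, and differentiable in $(z,\theta)$ with $\beta$-Lipschitz full gradient $\nabla\ell\in\mathbb R^{m+d}$. 2. $\ell$ is $\gamma$-strongly convex in $\theta$ in expectation: for all $\theta,\theta',\theta_0\in\Theta$,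 $$\mathbb E_{z\sim\mathcal D(\theta_0)}\ell(z;\theta)\ \ge\ \mathbb E_{z\sim\mathcal D(\theta_0)}\ell(z;\theta')+\big\langle\mathbb E_{z\sim\mathcal D(\theta_0)}\nabla_\theta\ell(z;\theta'),\,\theta-\theta'\big\rangle+\tfrac{\gamma}{2}\|\theta-\theta'\|_2^2 .$$ 3. $\ell$ is $\gamma_z$-strongly convex in $z$ with $\gamma_z\ge 0$: for all $\theta\in\Theta$ and $z,z'\in\mathcal Z$, $$\ell(z;\theta)\ \ge\ \ell(z';\theta)+\langle\nabla_z\ell(z';\theta),\,z-z'\rangle+\tfrac{\gamma_z}{2}\|z-z'\|_2^2 .$$ 4. $\mathcal D(\cdot)$ is $\epsilon$-sensitive with $\epsilon\ge0$: $W_1(\mathcal D(\theta),\mathcal D(\theta'))\le\epsilon\|\theta-\theta'\|_2$ for all $\theta,\theta'\in\Theta$. 5. $\lambda=\max\{\gamma-\beta^2/\gamma_z,\ \gamma-2\epsilon\beta+\gamma_z\sigma_{\min}^2(\mu)\}>0$, where $\sigma_{\min}(\mu)=\min_{\|\theta\|_2=1}\|\mu\theta\|_2$, and the first entry is omitted when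 $\gamma_z=0$. **Two-stage algorithm with parameter $n$.** Draw $\theta_1,\dots,\theta_n$ i.i.d. from $\mathcal N(0,I_d)$, and observe independent $z_i\sim\mathcal D(\theta_i)$. Let $\hat\mu\in\arg\min_{\nu\in\mathbb R^{m\times d}}\sum_{i=1}^n\|z_i-\nu\theta_i\|_2^2$ (ordinary least squares). Observe further independent samples $z_{n+1},\dots,z_{2n}\sim\mathcal D(0)$. Return $\hat\theta_n\in\arg\min_{\theta\in\Theta}\frac1n\sum_{j=n+1}^{2n}\ell(z_j+\hat\mu\theta;\theta)$. Assume that 6. with probability $1$, the perturbed performative risk $\widehat{\mathrm{PR}}(\theta)=\mathbb E_{z_0\sim\mathcal D_0}\ell(z_0+\hat\mu\theta;\theta)$ has a minimizer over $\Theta$ in the interior of $\Theta$. **Theorem.** For all $K,L_z,L,\beta,R,M$ and $\lambda>0$ there are constants $c,C>0$, depending on these numbers only, such that the following holds for all $d,m$, all $\mathcal D_0,\mu,\ell,\gamma,\gamma_z,\epsilon$ as in 1–5 with $\|\mu\|_{\mathrm{op}}\le M$, all $\delta\in(0,1)$, and all $n\ge c\,(d+m+\log(1/\delta))$ for which 6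 holds. The algorithm always has an output, and with probability at least $1-\delta$ every possible output $\hat\theta_n$ (however ties among minimizers are broken) satisfies $$\mathrm{PR}(\hat\theta_n)-\mathrm{PR}(\theta_{\mathrm{PO}})\ \le\ C\left(\frac{d+m+\log(1/\delta)}{n}+\frac{1}{\delta n}\right).$$ -/

import Mathlib

open MeasureTheory ProbabilityTheory Set Metric
open scoped ENNReal NNReal RealInnerProductSpace Gradient

noncomputable section

namespace Performative

/-- Euclidean space of dimension `k`. -/
abbrev Vec (k : ℕ) : Type := EuclideanSpace ℝ (Fin k)

/-- Linear maps from `ℝᵈ` to `ℝᵐ`, i.e. real `m × d` matrices, with the operator norm. -/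
abbrev LocMap (d m : ℕ) : Type := Vec d →L[ℝ] Vec m

/-! ### Location families and the performative risk -/

/-- The distribution map of a location family, as a Markov kernel:
`D(θ)` is the law of `z₀ + μ θ` with `z₀ ∼ D₀`. -/
def locationFamily {d m : ℕ} (D₀ : Measure (Vec m)) [IsProbabilityMeasure D₀] (μ : LocMap d m) :
    Kernel (Vec d) (Vec m) where
  toFun θ := D₀.map (fun z => z + μ θ)
  measurable' := by
    refine Measure.measurable_of_measurable_coe _ fun s hs => ?_
    have h : ∀ θ : Vec d, D₀.map (fun z => z + μ θ) s
        = D₀ (Prod.mk θ ⁻¹' ((fun p : Vec d × Vec m => p.2 + μ p.1) ⁻¹' s)) := fun θ => by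
      rw [Measure.map_apply (by fun_prop) hs]
      rfl
    simp_rw [h]
    exact measurable_measure_prodMk_left ((by fun_prop :
      Measurable (fun p : Vec d × Vec m => p.2 + μ p.1)) hs)

instance {d m : ℕ} (D₀ : Measure (Vec m)) [IsProbabilityMeasure D₀] (μ : LocMap d m) :
    IsMarkovKernel (locationFamily D₀ μ) where
  isProbabilityMeasure θ := Measure.isProbabilityMeasure_map
    (by fun_prop : Measurable (fun z : Vec m => z + μ θ)).aemeasurable

/-- The performative risk `PR(θ) = E_{z ∼ D(θ)} ℓ(z; θ)` of a location family. -/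
def performativeRisk {d m : ℕ} (D₀ : Measure (Vec m)) [IsProbabilityMeasure D₀] (μ : LocMap d m)
    (ℓ : Vec m → Vec d → ℝ) (θ : Vec d) : ℝ :=
  ∫ z, ℓ z θ ∂(locationFamily D₀ μ θ)

/-! ### Assumptions on the base distribution and on the distribution map -/

/-- A random vector with law `D₀` is subgaussian with parameter `K`: each one-dimensional
marginal along a unit vector `v` satisfies `E exp (t ⟪v, z⟫) ≤ exp (K² t² / 2)` for all `t`. -/
def IsSubgaussianVector {m : ℕ} (D₀ : Measure (Vec m)) (K : ℝ≥0) : Prop :=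
  ∀ v : Vec m, ‖v‖ = 1 → HasSubgaussianMGF (fun z => ⟪v, z⟫) (K ^ 2) D₀

/-- The Wasserstein-1 distance: infimum over all couplings of the expected distance. -/
def wasserstein1 {m : ℕ} (P Q : Measure (Vec m)) : ℝ≥0∞ :=
  ⨅ π ∈ {π : Measure (Vec m × Vec m) | π.map Prod.fst = P ∧ π.map Prod.snd = Q},
    ∫⁻ p, edist p.1 p.2 ∂π

/-- `ε`-sensitivity of a distribution map on `Θ`: it is `ε`-Lipschitz for `W₁`. -/
def IsSensitive {d m : ℕ} (D : Kernel (Vec d) (Vec m)) (Θ : Set (Vec d)) (ε : ℝ) : Prop :=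
  ∀ θ ∈ Θ, ∀ θ' ∈ Θ, wasserstein1 (D θ) (D θ') ≤ ENNReal.ofReal (ε * ‖θ - θ'‖)

/-- The set `𝒵 = ⋃_{θ ∈ Θ} supp D(θ)` of data points that can occur. -/
def dataSupport {d m : ℕ} (D : Kernel (Vec d) (Vec m)) (Θ : Set (Vec d)) : Set (Vec m) :=
  ⋃ θ ∈ Θ, (D θ).support

/-! ### Assumptions on the loss -/

/-- The loss as a function of the pair `(z, θ)`, an element of `ℝᵐ⁺ᵈ` with its Euclidean norm. -/
def jointLoss {d m : ℕ} (ℓ : Vec m → Vec d → ℝ) (p : WithLp 2 (Vec m × Vec d)) : ℝ :=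
  ℓ p.fst p.snd

/-- `β`-smoothness in `(z, θ)`, for `z ∈ ℝᵐ` and `θ ∈ Θ`: the loss is differentiable and its full
gradient in `ℝᵐ⁺ᵈ` is `β`-Lipschitz. -/
def IsJointlySmooth {d m : ℕ} (ℓ : Vec m → Vec d → ℝ) (Θ : Set (Vec d)) (β : ℝ≥0) : Prop :=
  (∀ p : WithLp 2 (Vec m × Vec d), p.snd ∈ Θ → DifferentiableAt ℝ (jointLoss ℓ) p) ∧
    LipschitzOnWith β (∇ (jointLoss ℓ)) {p | p.snd ∈ Θ}

/-- `γ`-strong convexity of the loss in `θ`, in expectation over each `D(θ₀)`, `θ₀ ∈ Θ`. -/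
def IsStronglyConvexInParam {d m : ℕ} (D : Kernel (Vec d) (Vec m)) (ℓ : Vec m → Vec d → ℝ)
    (Θ : Set (Vec d)) (γ : ℝ) : Prop :=
  ∀ θ ∈ Θ, ∀ θ' ∈ Θ, ∀ θ₀ ∈ Θ,
    (∫ z, ℓ z θ' ∂(D θ₀)) + ⟪∫ z, ∇ (fun t => ℓ z t) θ' ∂(D θ₀), θ - θ'⟫ + γ / 2 * ‖θ - θ'‖ ^ 2
      ≤ ∫ z, ℓ z θ ∂(D θ₀)

/-- `γz`-strong convexity of the loss in `z`, on the set `Z` of data points. -/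
def IsStronglyConvexInData {d m : ℕ} (ℓ : Vec m → Vec d → ℝ) (Θ : Set (Vec d)) (Z : Set (Vec m))
    (γz : ℝ) : Prop :=
  ∀ θ ∈ Θ, ∀ z ∈ Z, ∀ z' ∈ Z,
    ℓ z' θ + ⟪∇ (fun w => ℓ w θ) z', z - z'⟫ + γz / 2 * ‖z - z'‖ ^ 2 ≤ ℓ z θ

/-- `σ_min(μ) = min_{‖θ‖ = 1} ‖μ θ‖`. -/
def sigmaMin {d m : ℕ} (μ : LocMap d m) : ℝ :=
  sInf ((fun θ => ‖μ θ‖) '' sphere (0 : Vec d) 1)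

/-- `max {γ - β² / γz, γ - 2 ε β + γz σ²}`. For `γz = 0` the first entry is read as `-∞`
and so is left out. -/
def convexityParameter (γ γz ε β σ : ℝ) : ℝ :=
  if γz = 0 then γ - 2 * ε * β + γz * σ ^ 2
  else max (γ - β ^ 2 / γz) (γ - 2 * ε * β + γz * σ ^ 2)

/-! ### The two-stage algorithm -/

/-- The data that the algorithm collects: the pairs `(θᵢ, zᵢ)` of the experiment design, and the
second batch of `n` data points. -/
abbrev Data (d m n : ℕ) : Type := (Fin n → Vec d × Vec m) × (Fin n → Vec m)

/-- The law of the collected data: `n` independent pairs with `θᵢ ∼ N(0, I_d)` and, given `θᵢ`,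
`zᵢ ∼ D(θᵢ)`; and, independently of these, `n` independent samples from `D(0)`. -/
def dataLaw {d m : ℕ} (D : Kernel (Vec d) (Vec m)) (n : ℕ) : Measure (Data d m n) :=
  (Measure.pi fun _ : Fin n => (stdGaussian (Vec d)) ⊗ₘ D).prod
    (Measure.pi fun _ : Fin n => D 0)

/-- `μhat` is an ordinary least-squares estimate from the experiment-design data. -/
def IsOLS {d m n : ℕ} (x : Data d m n) (μhat : LocMap d m) : Prop :=
  IsMinOn (fun ν : LocMap d m => ∑ i, ‖(x.1 i).2 - ν (x.1 i).1‖ ^ 2) univ μhat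

/-- The finite-sample plug-in risk `(1/n) ∑ⱼ ℓ(zⱼ + μhat θ; θ)` over the second batch. -/
def empiricalRisk {d m n : ℕ} (ℓ : Vec m → Vec d → ℝ) (x : Data d m n) (μhat : LocMap d m)
    (θ : Vec d) : ℝ :=
  (1 / (n : ℝ)) * ∑ j, ℓ (x.2 j + μhat θ) θ

/-- `θhat` is a possible output of the two-stage algorithm on the data `x`: a minimizer over `Θ` of
the finite-sample plug-in risk for some least-squares estimate `μhat`. -/
def IsTwoStageOutput {d m n : ℕ} (ℓ : Vec m → Vec d → ℝ) (Θ : Set (Vec d)) (x : Data d m n)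
    (θhat : Vec d) : Prop :=
  ∃ μhat : LocMap d m, IsOLS x μhat ∧ θhat ∈ Θ ∧ IsMinOn (empiricalRisk ℓ x μhat) Θ θhat

/-- With probability one over the collected data, the perturbed performative risk
`θ ↦ E_{z₀ ∼ D₀} ℓ(z₀ + μhat θ; θ)` has a minimizer over `Θ` in the interior of `Θ`. -/
def HasInteriorPlugInMinimizer {d m : ℕ} (D₀ : Measure (Vec m)) [IsProbabilityMeasure D₀]
    (μ : LocMap d m) (ℓ : Vec m → Vec d → ℝ) (Θ : Set (Vec d)) (n : ℕ) : Prop :=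
  ∀ᵐ x ∂(dataLaw (locationFamily D₀ μ) n), ∀ μhat : LocMap d m, IsOLS x μhat →
    ∃ θ ∈ interior Θ, IsMinOn (performativeRisk D₀ μhat ℓ) Θ θ

end Performative

end

/-!
The performative risk `PR` of a location family grows quadratically around its minimizer, and this
turns errors that are linear in the distance `r = ‖θhat - θPO‖` into a fast rate. The risk has a
first-order lower bound with modulus `lam` between any two parameters (`exists_strong_convexity`):
split `PR θ - PR θ'` into a change of the data law and a change of the parameter, use convexity in
each, and pay `β s q` for evaluating the gradient in `z` at the wrong parameter, where `s` is the
length of the step and `q` the distance by which it moves the data. As `W₁` dominates the distance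
of means, `q ≤ ε s`. Adding up two of these bounds at a midpoint gives
`PR θ - PR θPO ≥ (lam / 4) r²` (`quadratic_growth_of_strong_convexity`), wherever `θPO` lies in the
ball.

Since `θhat` minimizes the empirical plug-in risk, `PR θhat - PR θPO` is bounded by a sum of errors
(`mul_excess_le`). Replacing the estimate of the location map by the true one changes increments of
the plug-in loss by `O(‖μhat - μ‖ r)`, for every single data point. What remains are deviations of
empirical means over the second batch, for the true location map, so that the two batches can be
treated separately:

* `‖μhat - μ‖² = O((d + m + log (1 / δ)) / n)` by `measure_ols_error_le`: the normal equations
  reduce the claim to the conditioning of the Gaussian design and to the noise-design correlations,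
  and both follow from exponential moments and a union bound over nets of the spheres.
* The mean of the gradients at `θPO` deviates by `O(1 / √(δ n))` by Chebyshev's inequality
  (`measure_norm_sum_sub_le`); this is the origin of the term `1 / (δ n)`.
* The mean of the first-order remainders deviates by at most `(lam / 16) r² + O(1 / n)`, uniformly
  over the ball (`exists_uniform_remainder_bound`). The remainder is quadratic in the distance to
  `θPO`, so that constant relative accuracy on each dyadic shell suffices, and no logarithm of `n`
  is lost. It is the growth of the population risk, and not convexity of the empirical risk, that
  absorbs this term.

The comparison is made with `θPO` itself, which may lie on the boundary of the ball, and not with a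
minimizer of the plug-in risk; `θPO` does not depend on the data, so that fixed functions are
averaged over the second batch.
-/

noncomputable section

namespace Performative

/-! ### Nets in Euclidean space -/

/-- Volume bound: the balls of radius `η ρ / 2` around the points of an `η ρ`-separated set are
disjoint and lie in a ball of radius `ρ + η ρ / 2`. -/
lemma card_le_of_separated {k : ℕ} {x : Vec k} {ρ η : ℝ} (hρ : 0 < ρ) (hη : 0 < η)
    (T : Finset (Vec k)) (hT : ∀ y ∈ T, y ∈ closedBall x ρ)
    (hsep : ∀ y ∈ T, ∀ z ∈ T, y ≠ z → η * ρ ≤ dist y z) :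
    (T.card : ℝ) ≤ (1 + 2 / η) ^ k := by
  have hr : 0 < η * ρ / 2 := by positivity
  have hR : 0 < ρ + η * ρ / 2 := by positivity
  have hdisj : (T : Set (Vec k)).PairwiseDisjoint fun c => ball c (η * ρ / 2) := by
    intro c hc e he hce
    exact ball_disjoint_ball (by linarith [hsep c hc e he hce])
  have hsub : (⋃ c ∈ T, ball c (η * ρ / 2)) ⊆ ball x (ρ + η * ρ / 2) := by
    refine iUnion₂_subset fun c hc => ball_subset_ball' ?_
    linarith [mem_closedBall.1 (hT c hc)]
  have hvol : (T.card : ℝ≥0∞) * ENNReal.ofReal ((η * ρ / 2) ^ k) * volume (ball (0 : Vec k) 1)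
      ≤ ENNReal.ofReal ((ρ + η * ρ / 2) ^ k) * volume (ball (0 : Vec k) 1) := by
    have h := measure_mono (μ := (volume : Measure (Vec k))) hsub
    rw [measure_biUnion_finset hdisj fun c _ => measurableSet_ball,
      Measure.addHaar_ball_of_pos _ _ hR] at h
    simp only [Measure.addHaar_ball_of_pos _ _ hr, finrank_euclideanSpace, Fintype.card_fin,
      Finset.sum_const, nsmul_eq_mul, ← mul_assoc] at h
    exact h
  rw [ENNReal.mul_le_mul_iff_left (measure_ball_pos _ _ zero_lt_one).ne' measure_ball_lt_top.ne]
    at hvol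
  have h2 := ENNReal.toReal_le_of_le_ofReal (by positivity) hvol
  rw [ENNReal.toReal_mul, ENNReal.toReal_natCast, ENNReal.toReal_ofReal (by positivity),
    ← le_div_iff₀ (by positivity), ← div_pow] at h2
  refine h2.trans (le_of_eq ?_)
  congr 1
  field_simp
  ring

/-- Every subset of a ball has a finite net consisting of points of the subset, with cardinality
exponential in the dimension: a separated subset of largest cardinality. -/
lemma exists_net {k : ℕ} {x : Vec k} {ρ η : ℝ} (hρ : 0 < ρ) (hη : 0 < η) {S : Set (Vec k)}
    (hS : S ⊆ closedBall x ρ) :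
    ∃ T : Finset (Vec k), (∀ y ∈ T, y ∈ S) ∧ (∀ y ∈ S, ∃ z ∈ T, ‖y - z‖ ≤ η * ρ) ∧
      (T.card : ℝ) ≤ (1 + 2 / η) ^ k := by
  classical
  let good : Finset (Vec k) → Prop := fun T =>
    (∀ y ∈ T, y ∈ S) ∧ ∀ y ∈ T, ∀ z ∈ T, y ≠ z → η * ρ ≤ dist y z
  have hcard : ∀ T, good T → (T.card : ℝ) ≤ (1 + 2 / η) ^ k := fun T hT =>
    card_le_of_separated hρ hη T (fun y hy => hS (hT.1 y hy)) hT.2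
  -- the cardinalities that occur
  let p : ℕ → Prop := fun N => ∃ T, good T ∧ T.card = N
  have hp0 : p 0 := ⟨∅, ⟨by simp, by simp⟩, rfl⟩
  have hbdd : BddAbove {N | p N} := by
    refine ⟨⌊(1 + 2 / η) ^ k⌋₊, ?_⟩
    rintro N ⟨T, hT, rfl⟩
    exact Nat.le_floor (hcard T hT)
  obtain ⟨T, hT, hTcard⟩ : p (sSup {N | p N}) := Nat.sSup_mem (s := {N | p N}) ⟨0, hp0⟩ hbdd
  refine ⟨T, hT.1, fun y hy => ?_, hcard T hT⟩
  by_contra! hfar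
  have hyT : y ∉ T := fun h => by
    have := hfar y h
    simp only [sub_self, norm_zero] at this
    nlinarith [mul_pos hη hρ]
  have hgood : good (insert y T) := by
    refine ⟨fun z hz => ?_, fun z hz w hw hzw => ?_⟩
    · rcases Finset.mem_insert.1 hz with rfl | hz
      exacts [hy, hT.1 z hz]
    · rcases Finset.mem_insert.1 hz with hzy | hzT <;> rcases Finset.mem_insert.1 hw with hwy | hwT
      · exact absurd (hzy.trans hwy.symm) hzw
      · rw [hzy, dist_eq_norm]; exact (hfar w hwT).le
      · rw [hwy, dist_comm, dist_eq_norm]; exact (hfar z hzT).le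
      · exact hT.2 z hzT w hwT hzw
  have := le_csSup hbdd (show p (insert y T).card from ⟨_, hgood, rfl⟩)
  rw [Finset.card_insert_of_notMem hyT, hTcard] at this
  omega

/-- The operator norm is controlled by the values on a net of the unit sphere. -/
lemma opNorm_le_of_net {k : ℕ} {F : Type*} [NormedAddCommGroup F] [NormedSpace ℝ F]
    (A : Vec k →L[ℝ] F) {η s : ℝ} (hη : η < 1) (hs : 0 ≤ s) (V : Finset (Vec k))
    (hV : ∀ y ∈ sphere (0 : Vec k) 1, ∃ z ∈ V, ‖y - z‖ ≤ η) (hA : ∀ z ∈ V, ‖A z‖ ≤ s) :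
    ‖A‖ ≤ s / (1 - η) := by
  have h1 : ‖A‖ ≤ s + η * ‖A‖ := by
    by_cases hη0 : 0 ≤ η
    · refine A.opNorm_le_of_unit_norm (by positivity) fun y hy => ?_
      obtain ⟨z, hz, hyz⟩ := hV y (by simpa using hy)
      calc ‖A y‖ = ‖A z + A (y - z)‖ := by rw [← map_add]; congr 2; abel
        _ ≤ ‖A z‖ + ‖A‖ * ‖y - z‖ := (norm_add_le _ _).trans (by gcongr; exact A.le_opNorm _)
        _ ≤ s + η * ‖A‖ := by rw [mul_comm η]; gcongr; exact hA z hz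
    · have : A = 0 := by
        refine (norm_eq_zero.1 (le_antisymm (A.opNorm_le_of_unit_norm le_rfl fun y hy => ?_)
          (norm_nonneg _)))
        obtain ⟨z, _, hyz⟩ := hV y (by simpa using hy)
        linarith [norm_nonneg (y - z)]
      simpa [this] using hs
  rw [le_div_iff₀ (by linarith)]
  linarith

/-- The norm of a vector is controlled by the inner products with a net of the unit sphere. -/
lemma norm_le_of_net {k : ℕ} (x : Vec k) {η s : ℝ} (hη : η < 1) (hs : 0 ≤ s) (U : Finset (Vec k))
    (hU : ∀ y ∈ sphere (0 : Vec k) 1, ∃ z ∈ U, ‖y - z‖ ≤ η) (hx : ∀ z ∈ U, ⟪z, x⟫ ≤ s) :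
    ‖x‖ ≤ s / (1 - η) := by
  rcases eq_or_ne x 0 with rfl | hx0
  · rw [norm_zero]; exact div_nonneg hs (by linarith)
  have hn : 0 < ‖x‖ := norm_pos_iff.2 hx0
  obtain ⟨z, hz, hyz⟩ := hU (‖x‖⁻¹ • x) (by simp [norm_smul, hn.ne'])
  have h1 : ⟪‖x‖⁻¹ • x, x⟫ = ‖x‖ := by
    rw [real_inner_smul_left, real_inner_self_eq_norm_sq]; field_simp
  have h2 : ⟪‖x‖⁻¹ • x - z, x⟫ ≤ η * ‖x‖ := (real_inner_le_norm _ _).trans (by gcongr)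
  rw [inner_sub_left, h1] at h2
  rw [le_div_iff₀ (by linarith)]
  linarith [hx z hz]

/-! ### Exponential tail bounds for independent samples -/

/-- Chernoff's bound for a sum of independent copies. -/
lemma pi_sum_ge_le {Ω : Type*} [MeasurableSpace Ω] (P : Measure Ω) [IsProbabilityMeasure P] {n : ℕ}
    {X : Ω → ℝ} (hX : Measurable X) {a : ℝ}
    (ha : ∫⁻ ω, ENNReal.ofReal (Real.exp (X ω)) ∂P ≤ ENNReal.ofReal (Real.exp a)) (s : ℝ) :
    (Measure.pi fun _ : Fin n => P) {x | s ≤ ∑ i, X (x i)}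
      ≤ ENNReal.ofReal (Real.exp (n * a - s)) := by
  have hm : Measurable fun ω => ENNReal.ofReal (Real.exp (X ω)) := by fun_prop
  have hprod : ∫⁻ x, ENNReal.ofReal (Real.exp (∑ i, X (x i))) ∂(Measure.pi fun _ : Fin n => P)
      ≤ ENNReal.ofReal (Real.exp (n * a)) := by
    have h1 : ∀ x : Fin n → Ω, ENNReal.ofReal (Real.exp (∑ i, X (x i)))
        = ∏ i, ENNReal.ofReal (Real.exp (X (x i))) := fun x => by
      rw [Real.exp_sum, ENNReal.ofReal_prod_of_nonneg fun i _ => (Real.exp_pos _).le]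
    simp_rw [h1]
    have hind : iIndepFun (fun (i : Fin n) (x : Fin n → Ω) => ENNReal.ofReal (Real.exp (X (x i))))
        (Measure.pi fun _ : Fin n => P) :=
      iIndepFun_pi (X := fun _ ω => ENNReal.ofReal (Real.exp (X ω))) fun i => hm.aemeasurable
    rw [lintegral_prod_eq_prod_lintegral_of_indepFun _ _ hind fun i => by fun_prop]
    have h2 : ∀ i : Fin n, ∫⁻ x, ENNReal.ofReal (Real.exp (X (x i)))
        ∂(Measure.pi fun _ : Fin n => P) = ∫⁻ ω, ENNReal.ofReal (Real.exp (X ω)) ∂P := fun i =>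
      (measurePreserving_eval (fun _ : Fin n => P) i).lintegral_comp hm
    simp_rw [h2, Finset.prod_const, Finset.card_univ, Fintype.card_fin]
    calc _ ≤ (ENNReal.ofReal (Real.exp a)) ^ n := by gcongr
      _ = _ := by rw [← ENNReal.ofReal_pow (Real.exp_pos _).le, Real.exp_nat_mul]
  calc (Measure.pi fun _ : Fin n => P) {x | s ≤ ∑ i, X (x i)}
      ≤ (Measure.pi fun _ : Fin n => P)
          {x | ENNReal.ofReal (Real.exp s) ≤ ENNReal.ofReal (Real.exp (∑ i, X (x i)))} :=
        measure_mono fun x hx => ENNReal.ofReal_le_ofReal (Real.exp_le_exp.2 hx)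
    _ ≤ (∫⁻ x, ENNReal.ofReal (Real.exp (∑ i, X (x i))) ∂(Measure.pi fun _ : Fin n => P))
          / ENNReal.ofReal (Real.exp s) :=
        meas_ge_le_lintegral_div (Finset.measurable_fun_sum _ fun i _ =>
          hX.comp (measurable_pi_apply i)).exp.ennreal_ofReal.aemeasurable
          (by simp [Real.exp_pos]) ENNReal.ofReal_ne_top
    _ ≤ ENNReal.ofReal (Real.exp (n * a)) / ENNReal.ofReal (Real.exp s) := by gcongr
    _ = _ := by rw [← ENNReal.ofReal_div_of_pos (Real.exp_pos _), ← Real.exp_sub]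

/-- Hoeffding's inequality, for the lower tail of a sum of independent copies. -/
lemma pi_mean_sub_ge_le {Ω : Type*} [MeasurableSpace Ω] (P : Measure Ω) [IsProbabilityMeasure P]
    {n : ℕ} {X : Ω → ℝ} (hX : Measurable X) {b τ : ℝ} (hb : 0 < b) (hτ : 0 ≤ τ)
    (hXb : ∀ ω, |X ω| ≤ b) :
    (Measure.pi fun _ : Fin n => P) {x | n * (τ * b) ≤ ∑ i, (∫ ω, X ω ∂P - X (x i))}
      ≤ ENNReal.ofReal (Real.exp (-(n * (τ ^ 2 / 2)))) := by
  have hsub : HasSubgaussianMGF (fun ω => X ω - ∫ ω, X ω ∂P) ((‖b - (-b)‖₊ / 2) ^ 2) P :=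
    hasSubgaussianMGF_of_mem_Icc hX.aemeasurable
      (Filter.Eventually.of_forall fun ω => abs_le.1 (hXb ω))
  have hb2 : (((‖b - (-b)‖₊ / 2) ^ 2 : ℝ≥0) : ℝ) = b ^ 2 := by
    push_cast
    rw [Real.norm_eq_abs, abs_of_pos (by linarith)]
    ring
  -- the exponential moment at the optimal parameter `τ / b`
  have hle := hsub.mgf_le (-(τ / b))
  rw [hb2] at hle
  have key : ∫⁻ ω, ENNReal.ofReal (Real.exp (τ / b * (∫ ω, X ω ∂P - X ω))) ∂P
      ≤ ENNReal.ofReal (Real.exp (τ ^ 2 / 2)) := by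
    have e : ∀ ω, τ / b * (∫ ω, X ω ∂P - X ω) = -(τ / b) * (X ω - ∫ ω, X ω ∂P) := fun ω => by ring
    simp_rw [e]
    rw [← ofReal_integral_eq_lintegral_ofReal (hsub.integrable_exp_mul _)
      (Filter.Eventually.of_forall fun ω => (Real.exp_pos _).le)]
    refine ENNReal.ofReal_le_ofReal (hle.trans (le_of_eq ?_))
    congr 1
    field_simp
  have := pi_sum_ge_le P (n := n) (X := fun ω => τ / b * (∫ ω, X ω ∂P - X ω)) (by fun_prop) key
    (n * τ ^ 2)
  refine (measure_mono fun x hx => ?_).trans (this.trans (le_of_eq ?_))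
  · change (n : ℝ) * τ ^ 2 ≤ _
    rw [← Finset.mul_sum]
    calc (n : ℝ) * τ ^ 2 = τ / b * (n * (τ * b)) := by field_simp
      _ ≤ _ := mul_le_mul_of_nonneg_left hx (by positivity)
  · congr 2; ring

/-- The exponential moments of the square of a standard Gaussian variable. -/
lemma lintegral_exp_sq_gaussianReal {a : ℝ} (ha : a < 1 / 2) :
    ∫⁻ x, ENNReal.ofReal (Real.exp (a * x ^ 2)) ∂(gaussianReal 0 1)
      = ENNReal.ofReal ((√(1 - 2 * a))⁻¹) := by
  have hb : 0 < 1 / 2 - a := by linarith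
  rw [gaussianReal_of_var_ne_zero 0 one_ne_zero,
    lintegral_withDensity_eq_lintegral_mul _ (measurable_gaussianPDF 0 1) (by fun_prop)]
  have e : ∀ x : ℝ, (gaussianPDF 0 1 * fun x => ENNReal.ofReal (Real.exp (a * x ^ 2))) x
      = ENNReal.ofReal ((√(2 * Real.pi))⁻¹ * Real.exp (-(1 / 2 - a) * x ^ 2)) := fun x => by
    simp only [Pi.mul_apply, gaussianPDF, gaussianPDFReal, NNReal.coe_one]
    rw [← ENNReal.ofReal_mul (by positivity), mul_assoc, ← Real.exp_add, mul_one]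
    congr 3
    ring
  simp_rw [e]
  rw [← ofReal_integral_eq_lintegral_ofReal ((integrable_exp_neg_mul_sq hb).const_mul _)
    (Filter.Eventually.of_forall fun x => by positivity), integral_const_mul, integral_gaussian]
  congr 1
  rw [← Real.sqrt_inv, ← Real.sqrt_mul (by positivity), ← Real.sqrt_inv]
  congr 1
  have : (1 - 2 * a) ≠ 0 := by linarith
  have := Real.pi_ne_zero
  field_simp

/-- The one-dimensional marginals of the standard Gaussian are standard Gaussian. -/
lemma map_inner_stdGaussian {d : ℕ} {v : Vec d} (hv : ‖v‖ = 1) :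
    (stdGaussian (Vec d)).map (fun θ => ⟪v, θ⟫) = gaussianReal 0 1 := by
  have h := IsGaussian.map_eq_gaussianReal (μ := stdGaussian (Vec d)) (innerSL ℝ v)
  rw [variance_dual_stdGaussian, integral_strongDual_stdGaussian, innerSL_apply_norm, hv] at h
  simpa using h

lemma lintegral_exp_sq_stdGaussian {d : ℕ} {v : Vec d} (hv : ‖v‖ = 1) {a : ℝ} (ha : a < 1 / 2) :
    ∫⁻ θ, ENNReal.ofReal (Real.exp (a * ⟪v, θ⟫ ^ 2)) ∂(stdGaussian (Vec d))
      = ENNReal.ofReal ((√(1 - 2 * a))⁻¹) := by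
  rw [← lintegral_exp_sq_gaussianReal ha, ← map_inner_stdGaussian hv,
    lintegral_map (by fun_prop) (by fun_prop)]

/-! ### Ordinary least squares -/

/-- The normal equations: the residuals of a least-squares estimate are orthogonal to the
predictions of every linear map. -/
lemma sum_inner_residual_eq_zero {d m n : ℕ} {x : Fin n → Vec d × Vec m} {μhat : LocMap d m}
    (h : IsMinOn (fun ν : LocMap d m => ∑ i, ‖(x i).2 - ν (x i).1‖ ^ 2) univ μhat)
    (ν : LocMap d m) : ∑ i, ⟪(x i).2 - μhat (x i).1, ν (x i).1⟫ = 0 := by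
  set S := ∑ i, ⟪(x i).2 - μhat (x i).1, ν (x i).1⟫ with hS
  set Q := ∑ i, ‖ν (x i).1‖ ^ 2 with hQ
  have hQ0 : 0 ≤ Q := Finset.sum_nonneg fun i _ => by positivity
  have hq : ∀ t : ℝ, 0 ≤ -2 * t * S + t ^ 2 * Q := fun t => by
    have h1 := h (mem_univ (μhat + t • ν))
    change ∑ i, ‖(x i).2 - μhat (x i).1‖ ^ 2
      ≤ ∑ i, ‖(x i).2 - (μhat (x i).1 + t • ν (x i).1)‖ ^ 2 at h1
    have e : ∀ i, ‖(x i).2 - (μhat (x i).1 + t • ν (x i).1)‖ ^ 2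
        = ‖(x i).2 - μhat (x i).1‖ ^ 2 + (-2 * t * ⟪(x i).2 - μhat (x i).1, ν (x i).1⟫
          + t ^ 2 * ‖ν (x i).1‖ ^ 2) := fun i => by
      rw [← sub_sub, norm_sub_sq_real, inner_smul_right, norm_smul, mul_pow, Real.norm_eq_abs,
        sq_abs]
      ring
    simp_rw [e, Finset.sum_add_distrib, ← Finset.mul_sum] at h1
    linarith
  -- the choice `S / Q` would be optimal; `Q + 1` avoids the case distinction `Q = 0`
  have h2 := hq (S / (Q + 1))
  have h3 : -2 * (S / (Q + 1)) * S + (S / (Q + 1)) ^ 2 * Q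
      = -(S ^ 2 * (Q + 2)) / (Q + 1) ^ 2 := by
    field_simp
    ring
  rw [h3, le_div_iff₀ (by positivity)] at h2
  have : S ^ 2 ≤ 0 := by nlinarith [sq_nonneg S]
  exact pow_eq_zero_iff two_ne_zero |>.1 (le_antisymm this (sq_nonneg S))

/-- The error of a least-squares estimate is at most the size of the noise-design correlations
divided by the smallest eigenvalue of the design. The normal equations are tested with the
rank-one maps `θ ↦ ⟪Δᵀ u, θ⟫ u`, where `Δ` is the error. -/
lemma opNorm_ols_sub_le {d m n : ℕ} {x : Fin n → Vec d × Vec m} {μhat : LocMap d m}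
    (h : IsMinOn (fun ν : LocMap d m => ∑ i, ‖(x i).2 - ν (x i).1‖ ^ 2) univ μhat)
    (μ : LocMap d m) {a B : ℝ} (ha : 0 < a) (hB : 0 ≤ B)
    (hdesign : ∀ v : Vec d, a * ‖v‖ ^ 2 ≤ ∑ i, ⟪v, (x i).1⟫ ^ 2)
    (hnoise : ∀ (u : Vec m) (v : Vec d),
      ∑ i, ⟪u, (x i).2 - μ (x i).1⟫ * ⟪v, (x i).1⟫ ≤ B * ‖u‖ * ‖v‖) :
    ‖μhat - μ‖ ≤ B / a := by
  rw [← (ContinuousLinearMap.adjoint (𝕜 := ℝ)).norm_map (μhat - μ)]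
  refine ContinuousLinearMap.opNorm_le_bound _ (by positivity) fun u => ?_
  set v := ContinuousLinearMap.adjoint (μhat - μ) u with hv
  have h0 := sum_inner_residual_eq_zero h ((innerSL ℝ v).smulRight u)
  have e : ∀ i, ⟪(x i).2 - μhat (x i).1, (innerSL ℝ v).smulRight u (x i).1⟫
      = ⟪u, (x i).2 - μ (x i).1⟫ * ⟪v, (x i).1⟫ - ⟪v, (x i).1⟫ ^ 2 := fun i => by
    have h1 : ⟪v, (x i).1⟫ = ⟪u, (μhat - μ) (x i).1⟫ :=
      ContinuousLinearMap.adjoint_inner_left _ _ _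
    have h2 : (x i).2 - μhat (x i).1 = ((x i).2 - μ (x i).1) - (μhat - μ) (x i).1 := by
      simp
    rw [ContinuousLinearMap.smulRight_apply, innerSL_apply_apply, inner_smul_right, h2,
      inner_sub_left, real_inner_comm u, real_inner_comm u, ← h1]
    ring
  simp_rw [e, Finset.sum_sub_distrib] at h0
  have h3 : a * ‖v‖ ^ 2 ≤ B * ‖u‖ * ‖v‖ := by linarith [hdesign v, hnoise u v]
  rcases (norm_nonneg v).eq_or_lt with h4 | h4
  · rw [← h4]; positivity
  · rw [div_mul_eq_mul_div, le_div_iff₀ ha]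
    nlinarith

/-- The design is well conditioned as soon as it is so on a net of the sphere. -/
lemma design_lower_bound_of_net {d n : ℕ} (θ : Fin n → Vec d) (V : Finset (Vec d))
    (hV : ∀ y ∈ sphere (0 : Vec d) 1, ∃ z ∈ V, ‖y - z‖ ≤ 1 / 9)
    (hlow : ∀ v ∈ V, (n : ℝ) / 4 ≤ ∑ i, ⟪v, θ i⟫ ^ 2)
    (hup : ∀ v ∈ V, ∑ i, ⟪v, θ i⟫ ^ 2 ≤ 4 * n) (v : Vec d) :
    (n : ℝ) / 16 * ‖v‖ ^ 2 ≤ ∑ i, ⟪v, θ i⟫ ^ 2 := by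
  let Φ : Vec d →L[ℝ] EuclideanSpace ℝ (Fin n) := LinearMap.toContinuousLinearMap
    { toFun := fun v => WithLp.toLp 2 fun i => ⟪v, θ i⟫
      map_add' := fun v w => by ext i; simp [inner_add_left]
      map_smul' := fun c v => by ext i; simp [inner_smul_left] }
  have hΦ : ∀ v, ‖Φ v‖ ^ 2 = ∑ i, ⟪v, θ i⟫ ^ 2 := fun v => by
    rw [EuclideanSpace.real_norm_sq_eq]
    rfl
  simp_rw [← hΦ] at hlow hup ⊢
  have hn0 : (0 : ℝ) ≤ n := Nat.cast_nonneg n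
  have hn : √n ^ 2 = n := Real.sq_sqrt hn0
  have hop : ‖Φ‖ ≤ 9 / 4 * √n := by
    refine (opNorm_le_of_net Φ (by norm_num : (1 / 9 : ℝ) < 1) (by positivity : 0 ≤ 2 * √n) V hV
      fun z hz => ?_).trans (le_of_eq (by ring))
    exact le_of_sq_le_sq (by rw [mul_pow, hn]; linarith [hup z hz]) (by positivity)
  have hunit : ∀ y ∈ sphere (0 : Vec d) 1, √n / 4 ≤ ‖Φ y‖ := fun y hy => by
    obtain ⟨z, hz, hyz⟩ := hV y hy
    have h1 : √n / 2 ≤ ‖Φ z‖ :=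
      le_of_sq_le_sq (by rw [div_pow, hn]; linarith [hlow z hz]) (norm_nonneg _)
    have h2 : ‖Φ z‖ ≤ ‖Φ y‖ + ‖Φ‖ * ‖y - z‖ := by
      calc ‖Φ z‖ = ‖Φ y - Φ (y - z)‖ := by rw [← map_sub]; congr 2; abel
        _ ≤ _ := (norm_sub_le _ _).trans (by gcongr; exact Φ.le_opNorm _)
    have h3 : ‖Φ‖ * ‖y - z‖ ≤ 9 / 4 * √n * (1 / 9) := by gcongr
    linarith
  rcases eq_or_ne v 0 with rfl | hv
  · simp
  have hv' : 0 < ‖v‖ := norm_pos_iff.2 hv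
  have h1 := hunit (‖v‖⁻¹ • v) (by simp [norm_smul, hv'.ne'])
  rw [map_smul, norm_smul, norm_inv, norm_norm, inv_mul_eq_div, le_div_iff₀ hv'] at h1
  calc (n : ℝ) / 16 * ‖v‖ ^ 2 = (√n / 4 * ‖v‖) ^ 2 := by rw [mul_pow, div_pow, hn]; ring
    _ ≤ _ := by gcongr

/-- The correlations between noise and design are small as soon as they are so on nets of the
spheres. -/
lemma noise_upper_bound_of_net {d m n : ℕ} (θ : Fin n → Vec d) (w : Fin n → Vec m)
    (V : Finset (Vec d)) (hV : ∀ y ∈ sphere (0 : Vec d) 1, ∃ z ∈ V, ‖y - z‖ ≤ 1 / 9)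
    (U : Finset (Vec m)) (hU : ∀ y ∈ sphere (0 : Vec m) 1, ∃ z ∈ U, ‖y - z‖ ≤ 1 / 9)
    {s : ℝ} (hs : 0 ≤ s) (h : ∀ u ∈ U, ∀ v ∈ V, ∑ i, ⟪u, w i⟫ * ⟪v, θ i⟫ ≤ s)
    (u : Vec m) (v : Vec d) : ∑ i, ⟪u, w i⟫ * ⟪v, θ i⟫ ≤ 2 * s * ‖u‖ * ‖v‖ := by
  let W : Vec d →L[ℝ] Vec m := ∑ i, (innerSL ℝ (θ i)).smulRight (w i)
  have hW : ∀ u v, ⟪u, W v⟫ = ∑ i, ⟪u, w i⟫ * ⟪v, θ i⟫ := fun u v => by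
    simp only [W, sum_apply, ContinuousLinearMap.smulRight_apply,
      innerSL_apply_apply, inner_sum, inner_smul_right]
    exact Finset.sum_congr rfl fun i _ => by rw [mul_comm, real_inner_comm v]
  simp_rw [← hW] at h ⊢
  have hop : ‖W‖ ≤ s / (1 - 1 / 9) / (1 - 1 / 9) :=
    opNorm_le_of_net W (by norm_num) (by positivity) V hV fun z hz =>
      norm_le_of_net (W z) (by norm_num) hs U hU fun u hu => h u hu z hz
  have hop2 : ‖W‖ ≤ 2 * s := by
    have e : s / (1 - 1 / 9) / (1 - 1 / 9) = 81 / 64 * s := by ring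
    linarith
  calc ⟪u, W v⟫ ≤ ‖u‖ * ‖W v‖ := real_inner_le_norm _ _
    _ ≤ ‖u‖ * (2 * s * ‖v‖) := by gcongr; exact W.le_of_opNorm_le hop2 v
    _ = _ := by ring

/-- The exponential moment of a squared Gaussian variable is subgaussian near the origin. -/
lemma inv_sqrt_one_sub_le_exp {x : ℝ} (h0 : 0 ≤ x) (h1 : x ≤ 1 / 2) :
    (√(1 - x))⁻¹ ≤ Real.exp x := by
  refine le_of_sq_le_sq ?_ (Real.exp_pos x).le
  rw [inv_pow, Real.sq_sqrt (by linarith), ← Real.exp_nat_mul, inv_le_iff_one_le_mul₀ (by linarith)]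
  push_cast
  nlinarith [Real.add_one_le_exp (2 * x)]

/-- The exponential moments of one product of noise and design. Given the design point, the noise
is subgaussian, which leaves an exponential moment of the square of a Gaussian variable. -/
lemma lintegral_exp_noise_mul_design {d m : ℕ} {D₀ : Measure (Vec m)} [IsProbabilityMeasure D₀]
    {K : ℝ≥0} (hK : IsSubgaussianVector D₀ K) (μ : LocMap d m) {u : Vec m} (hu : ‖u‖ = 1)
    {v : Vec d} (hv : ‖v‖ = 1) {t : ℝ} (ht : (K : ℝ) ^ 2 * t ^ 2 ≤ 1 / 2) :
    ∫⁻ x, ENNReal.ofReal (Real.exp (t * (⟪u, x.2 - μ x.1⟫ * ⟪v, x.1⟫)))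
        ∂((stdGaussian (Vec d)) ⊗ₘ (locationFamily D₀ μ))
      ≤ ENNReal.ofReal (Real.exp (K ^ 2 * t ^ 2)) := by
  rw [Measure.lintegral_compProd (by fun_prop)]
  have h1 : ∀ θ : Vec d, ∫⁻ z, ENNReal.ofReal (Real.exp (t * (⟪u, z - μ θ⟫ * ⟪v, θ⟫)))
      ∂(locationFamily D₀ μ θ)
      ≤ ENNReal.ofReal (Real.exp (K ^ 2 * t ^ 2 / 2 * ⟪v, θ⟫ ^ 2)) := fun θ => by
    change ∫⁻ z, _ ∂(D₀.map (fun z => z + μ θ)) ≤ _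
    rw [lintegral_map (by fun_prop) (by fun_prop)]
    have e : ∀ z, t * (⟪u, z + μ θ - μ θ⟫ * ⟪v, θ⟫) = t * ⟪v, θ⟫ * ⟪u, z⟫ := fun z => by
      rw [add_sub_cancel_right]; ring
    simp_rw [e]
    rw [← ofReal_integral_eq_lintegral_ofReal ((hK u hu).integrable_exp_mul _)
      (Filter.Eventually.of_forall fun z => (Real.exp_pos _).le)]
    refine ENNReal.ofReal_le_ofReal (((hK u hu).mgf_le _).trans (le_of_eq ?_))
    push_cast
    congr 1
    ring
  refine (lintegral_mono h1).trans ?_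
  rw [lintegral_exp_sq_stdGaussian hv (by linarith)]
  refine ENNReal.ofReal_le_ofReal ?_
  rw [show 1 - 2 * ((K : ℝ) ^ 2 * t ^ 2 / 2) = 1 - K ^ 2 * t ^ 2 by ring]
  exact inv_sqrt_one_sub_le_exp (by positivity) ht

/-- An exponential moment of the design point alone. -/
lemma lintegral_exp_design {d m : ℕ} (D : Kernel (Vec d) (Vec m)) [IsMarkovKernel D] {v : Vec d}
    (hv : ‖v‖ = 1) {a : ℝ} (ha : a < 1 / 2) :
    ∫⁻ x, ENNReal.ofReal (Real.exp (a * ⟪v, x.1⟫ ^ 2)) ∂((stdGaussian (Vec d)) ⊗ₘ D)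
      = ENNReal.ofReal ((√(1 - 2 * a))⁻¹) := by
  rw [Measure.lintegral_compProd (by fun_prop)]
  simp only [lintegral_const, measure_univ, mul_one]
  exact lintegral_exp_sq_stdGaussian hv ha

/-- The lower tail of a squared marginal of the design. The choice `-3 / 2` of the parameter of the
exponential moment makes the moment equal to `1 / 2`. -/
lemma measure_design_lt_le {d m : ℕ} (D : Kernel (Vec d) (Vec m)) [IsMarkovKernel D] (n : ℕ)
    {v : Vec d} (hv : ‖v‖ = 1) :
    (Measure.pi fun _ : Fin n => (stdGaussian (Vec d)) ⊗ₘ D)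
      {x | ∑ i, ⟪v, (x i).1⟫ ^ 2 < (n : ℝ) / 4} ≤ ENNReal.ofReal (Real.exp (-(3 / 10 * n))) := by
  have key : ∫⁻ x, ENNReal.ofReal (Real.exp (-(3 / 2) * ⟪v, x.1⟫ ^ 2))
      ∂((stdGaussian (Vec d)) ⊗ₘ D) ≤ ENNReal.ofReal (Real.exp (-(27 / 40))) := by
    rw [lintegral_exp_design D hv (by norm_num)]
    refine ENNReal.ofReal_le_ofReal ?_
    rw [show (1 - 2 * (-(3 / 2)) : ℝ) = 2 ^ 2 by norm_num, Real.sqrt_sq (by norm_num),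
      ← Real.exp_log (show (0 : ℝ) < 2⁻¹ by norm_num), Real.log_inv, Real.exp_le_exp]
    linarith [Real.log_two_gt_d9]
  refine (measure_mono fun x hx => ?_).trans ((pi_sum_ge_le ((stdGaussian (Vec d)) ⊗ₘ D)
    (X := fun x => -(3 / 2) * ⟪v, x.1⟫ ^ 2) (n := n) (by fun_prop) key (-(3 / 8) * n)).trans
      (ENNReal.ofReal_le_ofReal (Real.exp_le_exp.2 (by linarith))))
  have hx' : ∑ i, ⟪v, (x i).1⟫ ^ 2 < (n : ℝ) / 4 := hx
  change -(3 / 8) * (n : ℝ) ≤ _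
  rw [← Finset.mul_sum]
  linarith

/-- The upper tail of a squared marginal of the design. -/
lemma measure_lt_design_le {d m : ℕ} (D : Kernel (Vec d) (Vec m)) [IsMarkovKernel D] (n : ℕ)
    {v : Vec d} (hv : ‖v‖ = 1) :
    (Measure.pi fun _ : Fin n => (stdGaussian (Vec d)) ⊗ₘ D)
      {x | 4 * (n : ℝ) < ∑ i, ⟪v, (x i).1⟫ ^ 2} ≤ ENNReal.ofReal (Real.exp (-(3 / 10 * n))) := by
  have key : ∫⁻ x, ENNReal.ofReal (Real.exp (1 / 4 * ⟪v, x.1⟫ ^ 2))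
      ∂((stdGaussian (Vec d)) ⊗ₘ D) ≤ ENNReal.ofReal (Real.exp (1 / 2)) := by
    rw [lintegral_exp_design D hv (by norm_num)]
    refine ENNReal.ofReal_le_ofReal ?_
    rw [show (1 - 2 * (1 / 4) : ℝ) = 1 - 1 / 2 by norm_num]
    exact inv_sqrt_one_sub_le_exp (by norm_num) le_rfl
  refine (measure_mono fun x hx => ?_).trans ((pi_sum_ge_le ((stdGaussian (Vec d)) ⊗ₘ D)
    (X := fun x => 1 / 4 * ⟪v, x.1⟫ ^ 2) (n := n) (by fun_prop) key n).trans
      (ENNReal.ofReal_le_ofReal (Real.exp_le_exp.2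
        (by linarith [(Nat.cast_nonneg n : (0 : ℝ) ≤ n)]))))
  have hx' : 4 * (n : ℝ) < ∑ i, ⟪v, (x i).1⟫ ^ 2 := hx
  change (n : ℝ) ≤ _
  rw [← Finset.mul_sum]
  linarith

/-- The upper tail of a noise-design correlation. `K + 1` in place of `K` avoids a division by zero
for a degenerate base distribution. -/
lemma measure_lt_noise_mul_design_le {d m : ℕ} {D₀ : Measure (Vec m)} [IsProbabilityMeasure D₀]
    {K : ℝ≥0} (hK : IsSubgaussianVector D₀ K) (μ : LocMap d m) {u : Vec m} (hu : ‖u‖ = 1)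
    {v : Vec d} (hv : ‖v‖ = 1) {n : ℕ} {D : ℝ} (hD : 0 < D) (hn : 2 * D ≤ n) :
    (Measure.pi fun _ : Fin n => (stdGaussian (Vec d)) ⊗ₘ (locationFamily D₀ μ))
      {x | 8 * (K + 1) * √(n * D) < ∑ i, ⟪u, (x i).2 - μ (x i).1⟫ * ⟪v, (x i).1⟫}
      ≤ ENNReal.ofReal (Real.exp (-(7 * D))) := by
  have hn0 : (0 : ℝ) < n := by linarith
  have hK0 : (0 : ℝ) ≤ K := K.2
  -- the parameter of the exponential moment
  set t : ℝ := √(D / n) / (K + 1) with ht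
  have ht0 : 0 ≤ t := by positivity
  have ht2 : (K : ℝ) ^ 2 * t ^ 2 ≤ D / n := by
    rw [ht, div_pow, Real.sq_sqrt (by positivity), mul_div_assoc', div_le_iff₀ (by positivity),
      mul_comm]
    gcongr
    linarith
  have hDn : D / n ≤ 1 / 2 := by rw [div_le_iff₀ hn0]; linarith
  have key := lintegral_exp_noise_mul_design hK μ hu hv (ht2.trans hDn)
  have hs : t * (8 * (K + 1) * √(n * D)) = 8 * D := by
    have : √(D / n) * √(n * D) = D := by
      rw [← Real.sqrt_mul (by positivity), show D / n * (n * D) = D ^ 2 by field_simp,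
        Real.sqrt_sq hD.le]
    have hK1 : (K : ℝ) + 1 ≠ 0 := by positivity
    calc t * (8 * (K + 1) * √(n * D)) = 8 * (√(D / n) * √(n * D)) := by
          rw [ht]; field_simp
      _ = 8 * D := by rw [this]
  refine (measure_mono fun x hx => ?_).trans ((pi_sum_ge_le
    ((stdGaussian (Vec d)) ⊗ₘ (locationFamily D₀ μ))
    (X := fun x => t * (⟪u, x.2 - μ x.1⟫ * ⟪v, x.1⟫)) (n := n) (by fun_prop) key (8 * D)).trans
      (ENNReal.ofReal_le_ofReal (Real.exp_le_exp.2 ?_)))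
  · have hx' : 8 * (K + 1) * √(n * D) < ∑ i, ⟪u, (x i).2 - μ (x i).1⟫ * ⟪v, (x i).1⟫ := hx
    change 8 * D ≤ _
    rw [← Finset.mul_sum, ← hs]
    gcongr
  · have : (n : ℝ) * (K ^ 2 * t ^ 2) ≤ n * (D / n) := by gcongr
    rw [mul_div_cancel₀ _ hn0.ne'] at this
    linarith

/-- A union bound over a finite set, in real-valued form. -/
lemma measure_exists_mem_le {Ω ι : Type*} [MeasurableSpace Ω] (P : Measure Ω) (T : Finset ι)
    (E : ι → Set Ω) {c q : ℝ} (hc : (T.card : ℝ) ≤ c) (hq : 0 ≤ q)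
    (hE : ∀ v ∈ T, P (E v) ≤ ENNReal.ofReal q) :
    P {x | ∃ v ∈ T, x ∈ E v} ≤ ENNReal.ofReal (c * q) := by
  have : {x | ∃ v ∈ T, x ∈ E v} = ⋃ v ∈ T, E v := by ext; simp
  rw [this]
  calc P (⋃ v ∈ T, E v) ≤ ∑ v ∈ T, P (E v) := measure_biUnion_finset_le _ _
    _ ≤ ∑ v ∈ T, ENNReal.ofReal q := Finset.sum_le_sum hE
    _ = ENNReal.ofReal (T.card * q) := by
      rw [Finset.sum_const, nsmul_eq_mul, ENNReal.ofReal_mul (Nat.cast_nonneg _),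
        ENNReal.ofReal_natCast]
    _ ≤ _ := ENNReal.ofReal_le_ofReal (by gcongr)

/-- The size of a `1 / 9`-net of the sphere, as an exponential. -/
lemma pow_nineteen_le_exp (k : ℕ) : (1 + 2 / (1 / 9) : ℝ) ^ k ≤ Real.exp (3 * k) := by
  have h : (1 + 2 / (1 / 9) : ℝ) ≤ Real.exp 3 := by
    have h1 : Real.exp 3 = Real.exp 1 ^ 3 := by rw [← Real.exp_nat_mul]; norm_num
    rw [h1]
    calc (1 + 2 / (1 / 9) : ℝ) ≤ 2.718 ^ 3 := by norm_num
      _ ≤ _ := by gcongr; linarith [Real.exp_one_gt_d9]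
  calc _ ≤ Real.exp 3 ^ k := by gcongr
    _ = _ := by rw [← Real.exp_nat_mul]; ring_nf

lemma exp_neg_le_mul_of_log {x D δ : ℝ} (hδ : 0 < δ) (hD : 1 ≤ D) (hlog : Real.log (1 / δ) ≤ D)
    (hx : 4 * D ≤ x) : Real.exp (-x) ≤ δ / 8 := by
  have h3 : Real.exp (-3) ≤ 1 / 8 := by
    rw [Real.exp_neg, inv_le_comm₀ (Real.exp_pos _) (by norm_num)]
    have h1 : Real.exp 3 = Real.exp 1 ^ 3 := by rw [← Real.exp_nat_mul]; norm_num
    rw [h1]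
    calc (1 / 8 : ℝ)⁻¹ ≤ 2 ^ 3 := by norm_num
      _ ≤ _ := by gcongr; linarith [Real.exp_one_gt_d9]
  calc Real.exp (-x) ≤ Real.exp (-Real.log (1 / δ) + -3) := Real.exp_le_exp.2 (by linarith)
    _ = δ * Real.exp (-3) := by
      rw [Real.exp_add, one_div, Real.log_inv, neg_neg, Real.exp_log hδ]
    _ ≤ δ / 8 := by nlinarith

/-- With high probability every least-squares estimate is within `O(√(D / n))` of the true
location map in operator norm, where `D` bounds `d + m + log (1 / δ)`. -/
theorem measure_ols_error_le {d m : ℕ} {D₀ : Measure (Vec m)} [IsProbabilityMeasure D₀]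
    {K : ℝ≥0} (hK : IsSubgaussianVector D₀ K) (μ : LocMap d m) (hd : 1 ≤ d) {n : ℕ} {δ : ℝ}
    (hδ : 0 < δ) (hδ1 : δ < 1) (hn : 30 * (d + m + Real.log (1 / δ)) ≤ n) :
    (Measure.pi fun _ : Fin n => (stdGaussian (Vec d)) ⊗ₘ (locationFamily D₀ μ))
      {x | ∃ μhat : LocMap d m,
        IsMinOn (fun ν : LocMap d m => ∑ i, ‖(x i).2 - ν (x i).1‖ ^ 2) univ μhat ∧
        256 * (K + 1) * √((d + m + Real.log (1 / δ)) / n) < ‖μhat - μ‖}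
      ≤ ENNReal.ofReal (δ / 2) := by
  set D : ℝ := d + m + Real.log (1 / δ) with hDdef
  set P := Measure.pi fun _ : Fin n => (stdGaussian (Vec d)) ⊗ₘ (locationFamily D₀ μ) with hP
  have hlog : 0 < Real.log (1 / δ) := Real.log_pos (by rw [lt_div_iff₀ hδ]; linarith)
  have hd1 : (1 : ℝ) ≤ d := by exact_mod_cast hd
  have hm0 : (0 : ℝ) ≤ m := Nat.cast_nonneg m
  have hD1 : 1 ≤ D := by linarith
  have hn0 : (0 : ℝ) < n := by linarith
  have hK0 : (0 : ℝ) ≤ K := K.2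
  obtain ⟨V, hVS, hV, hVc⟩ := exists_net (k := d) one_pos (by norm_num : (0 : ℝ) < 1 / 9)
    (sphere_subset_closedBall (x := (0 : Vec d)) (ε := 1))
  obtain ⟨U, hUS, hU, hUc⟩ := exists_net (k := m) one_pos (by norm_num : (0 : ℝ) < 1 / 9)
    (sphere_subset_closedBall (x := (0 : Vec m)) (ε := 1))
  rw [mul_one] at hV hU
  set s : ℝ := 8 * (K + 1) * √(n * D) with hs
  -- the design is too small, or too large, or too correlated with the noise, on the nets
  let E1 : Set (Fin n → Vec d × Vec m) :=
    {x | ∃ v ∈ V, x ∈ {x : Fin n → Vec d × Vec m | ∑ i, ⟪v, (x i).1⟫ ^ 2 < (n : ℝ) / 4}}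
  let E2 : Set (Fin n → Vec d × Vec m) :=
    {x | ∃ v ∈ V, x ∈ {x : Fin n → Vec d × Vec m | 4 * (n : ℝ) < ∑ i, ⟪v, (x i).1⟫ ^ 2}}
  let E3 : Set (Fin n → Vec d × Vec m) := {x | ∃ p ∈ U ×ˢ V,
    x ∈ {x : Fin n → Vec d × Vec m | s < ∑ i, ⟪p.1, (x i).2 - μ (x i).1⟫ * ⟪p.2, (x i).1⟫}}
  have hVc' := hVc.trans (pow_nineteen_le_exp d)
  have hUc' := hUc.trans (pow_nineteen_le_exp m)
  have hdes : Real.exp (3 * d) * Real.exp (-(3 / 10 * n)) ≤ δ / 8 := by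
    rw [← Real.exp_add, show (3 * d + -(3 / 10 * n) : ℝ) = -(3 / 10 * n - 3 * d) by ring]
    exact exp_neg_le_mul_of_log hδ hD1 (by linarith) (by linarith)
  have h1 : P E1 ≤ ENNReal.ofReal (δ / 8) :=
    (measure_exists_mem_le P V _ hVc' (Real.exp_pos _).le fun v hv =>
      measure_design_lt_le _ n (by simpa using hVS v hv)).trans (ENNReal.ofReal_le_ofReal hdes)
  have h2 : P E2 ≤ ENNReal.ofReal (δ / 8) :=
    (measure_exists_mem_le P V _ hVc' (Real.exp_pos _).le fun v hv =>
      measure_lt_design_le _ n (by simpa using hVS v hv)).trans (ENNReal.ofReal_le_ofReal hdes)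
  have h3 : P E3 ≤ ENNReal.ofReal (δ / 8) := by
    refine (measure_exists_mem_le P (U ×ˢ V) _ (c := Real.exp (3 * m) * Real.exp (3 * d)) ?_
      (Real.exp_pos (-(7 * D))).le fun p hp => ?_).trans (ENNReal.ofReal_le_ofReal ?_)
    · rw [Finset.card_product, Nat.cast_mul]
      gcongr
    · rw [Finset.mem_product] at hp
      exact measure_lt_noise_mul_design_le hK μ (by simpa using hUS _ hp.1)
        (by simpa using hVS _ hp.2) (by linarith) (by linarith)
    · rw [← Real.exp_add, ← Real.exp_add,
        show (3 * m + 3 * d + -(7 * D) : ℝ) = -(7 * D - 3 * d - 3 * m) by ring]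
      exact exp_neg_le_mul_of_log hδ hD1 (by linarith) (by linarith)
  have hsub : {x | ∃ μhat : LocMap d m,
        IsMinOn (fun ν : LocMap d m => ∑ i, ‖(x i).2 - ν (x i).1‖ ^ 2) univ μhat ∧
        256 * (K + 1) * √(D / n) < ‖μhat - μ‖} ⊆ E1 ∪ (E2 ∪ E3) := by
    rintro x ⟨μhat, hols, hlarge⟩
    by_contra hx
    simp only [mem_union, not_or] at hx
    obtain ⟨hx1, hx2, hx3⟩ := hx
    have hlow : ∀ v ∈ V, (n : ℝ) / 4 ≤ ∑ i, ⟪v, (x i).1⟫ ^ 2 := fun v hv =>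
      not_lt.1 fun h => hx1 ⟨v, hv, h⟩
    have hup : ∀ v ∈ V, ∑ i, ⟪v, (x i).1⟫ ^ 2 ≤ 4 * n := fun v hv =>
      not_lt.1 fun h => hx2 ⟨v, hv, h⟩
    have hcross : ∀ u ∈ U, ∀ v ∈ V, ∑ i, ⟪u, (x i).2 - μ (x i).1⟫ * ⟪v, (x i).1⟫ ≤ s :=
      fun u hu v hv => not_lt.1 fun h => hx3 ⟨(u, v), Finset.mk_mem_product hu hv, h⟩
    have hs0 : 0 ≤ s := by positivity
    have hle := opNorm_ols_sub_le hols μ (by positivity : (0 : ℝ) < n / 16)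
      (by positivity : 0 ≤ 2 * s) (design_lower_bound_of_net _ V hV hlow hup)
      (noise_upper_bound_of_net (fun i => (x i).1) (fun i => (x i).2 - μ (x i).1) V hV U hU hs0
        hcross)
    have e : 2 * s / (n / 16) = 256 * (K + 1) * √(D / n) := by
      have : √(n * D) = n * √(D / n) := by
        rw [show (n : ℝ) * D = n ^ 2 * (D / n) by field_simp, Real.sqrt_mul (by positivity),
          Real.sqrt_sq hn0.le]
      rw [hs, this]
      field_simp
      ring
    linarith
  calc _ ≤ P (E1 ∪ (E2 ∪ E3)) := measure_mono hsub
    _ ≤ P E1 + (P E2 + P E3) := (measure_union_le _ _).trans (by gcongr; exact measure_union_le _ _)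
    _ ≤ ENNReal.ofReal (δ / 8) + (ENNReal.ofReal (δ / 8) + ENNReal.ofReal (δ / 8)) := by gcongr
    _ = ENNReal.ofReal (δ / 8 + (δ / 8 + δ / 8)) := by
      rw [ENNReal.ofReal_add, ENNReal.ofReal_add] <;> positivity
    _ ≤ _ := ENNReal.ofReal_le_ofReal (by linarith)

lemma exists_dist_range_le {E F : Type*} [AddCommGroup E] [Module ℝ E] [NormedAddCommGroup F]
    [NormedSpace ℝ F] [FiniteDimensional ℝ F] (T : E →ₗ[ℝ] F) (y : F) :
    ∃ x, ∀ x', ‖y - T x‖ ≤ ‖y - T x'‖ := by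
  have : ProperSpace F := FiniteDimensional.proper ℝ F
  obtain ⟨p, ⟨x, rfl⟩, hp⟩ := (Submodule.closed_of_finiteDimensional
    (LinearMap.range T)).exists_infDist_eq_dist ⟨0, Submodule.zero_mem _⟩ y
  refine ⟨x, fun x' => ?_⟩
  rw [← dist_eq_norm, ← dist_eq_norm, ← hp]
  exact infDist_le_dist_of_mem ⟨x', rfl⟩

/-- A least-squares estimate exists for all data: the predictions form a closed subspace. -/
lemma exists_ols {d m n : ℕ} (x : Fin n → Vec d × Vec m) : ∃ μhat : LocMap d m,
    IsMinOn (fun ν : LocMap d m => ∑ i, ‖(x i).2 - ν (x i).1‖ ^ 2) univ μhat := by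
  let T : LocMap d m →ₗ[ℝ] PiLp 2 fun _ : Fin n => Vec m :=
    { toFun := fun ν => WithLp.toLp 2 fun i => ν (x i).1
      map_add' := fun _ _ => rfl
      map_smul' := fun _ _ => rfl }
  let y : PiLp 2 fun _ : Fin n => Vec m := WithLp.toLp 2 fun i => (x i).2
  obtain ⟨μhat, h⟩ := exists_dist_range_le T y
  have hT : ∀ ν, ∑ i, ‖(x i).2 - ν (x i).1‖ ^ 2 = ‖y - T ν‖ ^ 2 := fun ν => by
    rw [PiLp.norm_sq_eq_of_L2]
    rfl
  refine ⟨μhat, fun ν _ => ?_⟩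
  change ∑ i, ‖(x i).2 - μhat (x i).1‖ ^ 2 ≤ ∑ i, ‖(x i).2 - ν (x i).1‖ ^ 2
  rw [hT, hT]
  exact pow_le_pow_left₀ (norm_nonneg _) (h ν) 2

/-! ### Calculus of the plug-in loss -/

/-- Chain rule for gradients along an affine map. -/
lemma hasGradientAt_comp_affine {X Y : Type*} [NormedAddCommGroup X] [InnerProductSpace ℝ X]
    [CompleteSpace X] [NormedAddCommGroup Y] [InnerProductSpace ℝ Y] [CompleteSpace Y] {F : Y → ℝ}
    (A : X →L[ℝ] Y) (p : Y) (x : X) (hF : DifferentiableAt ℝ F (p + A x)) :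
    HasGradientAt (fun t => F (p + A t)) (ContinuousLinearMap.adjoint A (∇ F (p + A x))) x := by
  have h1 : HasFDerivAt (fun t => p + A t) A x := A.hasFDerivAt.const_add p
  have h2 := (hF.hasGradientAt.hasFDerivAt).comp x h1
  rw [hasGradientAt_iff_hasFDerivAt]
  refine h2.congr_fderiv ?_
  ext v
  simp [ContinuousLinearMap.adjoint_inner_left]

/-- The direction `θ ↦ (μ θ, θ)` in which the pair (data point, parameter) moves. -/
def shiftMap {d m : ℕ} (μ : LocMap d m) : Vec d →L[ℝ] WithLp 2 (Vec m × Vec d) :=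
  ((WithLp.prodContinuousLinearEquiv 2 ℝ (Vec m) (Vec d)).symm :
    Vec m × Vec d →L[ℝ] WithLp 2 (Vec m × Vec d)) ∘L (μ.prod (ContinuousLinearMap.id ℝ (Vec d)))

/-- The inclusion `z ↦ (z, 0)` of the data space. -/
def dataIncl (d m : ℕ) : Vec m →L[ℝ] WithLp 2 (Vec m × Vec d) :=
  ((WithLp.prodContinuousLinearEquiv 2 ℝ (Vec m) (Vec d)).symm :
    Vec m × Vec d →L[ℝ] WithLp 2 (Vec m × Vec d)) ∘L (ContinuousLinearMap.inl ℝ (Vec m) (Vec d))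

lemma shiftMap_apply {d m : ℕ} (μ : LocMap d m) (θ : Vec d) :
    shiftMap μ θ = WithLp.toLp 2 (μ θ, θ) := rfl

lemma dataIncl_apply {d m : ℕ} (z : Vec m) : dataIncl d m z = WithLp.toLp 2 (z, 0) := rfl

lemma norm_dataIncl_apply {d m : ℕ} (z : Vec m) : ‖dataIncl d m z‖ = ‖z‖ := by
  rw [dataIncl_apply, WithLp.prod_norm_eq_of_L2]
  simp [Real.sqrt_sq]

lemma norm_toLp_le {d m : ℕ} (z : Vec m) (θ : Vec d) : ‖WithLp.toLp 2 (z, θ)‖ ≤ ‖z‖ + ‖θ‖ := by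
  rw [WithLp.prod_norm_eq_of_L2, Real.sqrt_le_left (by positivity)]
  change ‖z‖ ^ 2 + ‖θ‖ ^ 2 ≤ _
  nlinarith [norm_nonneg z, norm_nonneg θ]

lemma norm_toLp_zero_left {d m : ℕ} (θ : Vec d) :
    ‖(WithLp.toLp 2 ((0 : Vec m), θ) : WithLp 2 (Vec m × Vec d))‖ = ‖θ‖ := by
  rw [WithLp.prod_norm_eq_of_L2]
  simp [Real.sqrt_sq]

lemma norm_fst_le {d m : ℕ} (p : WithLp 2 (Vec m × Vec d)) : ‖p.fst‖ ≤ ‖p‖ := by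
  rw [WithLp.prod_norm_eq_of_L2]
  exact Real.le_sqrt_of_sq_le (by linarith [sq_nonneg ‖p.snd‖])

lemma norm_snd_le {d m : ℕ} (p : WithLp 2 (Vec m × Vec d)) : ‖p.snd‖ ≤ ‖p‖ := by
  rw [WithLp.prod_norm_eq_of_L2]
  exact Real.le_sqrt_of_sq_le (by linarith [sq_nonneg ‖p.fst‖])

lemma norm_shiftMap_le {d m : ℕ} (μ : LocMap d m) : ‖shiftMap μ‖ ≤ ‖μ‖ + 1 := by
  refine ContinuousLinearMap.opNorm_le_bound _ (by positivity) fun θ => ?_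
  rw [shiftMap_apply]
  refine (norm_toLp_le _ _).trans ?_
  linarith [μ.le_opNorm θ]

/-- The gradient in `θ` of the plug-in loss `θ ↦ ℓ (z + μ θ; θ)`. -/
def plugInGrad {d m : ℕ} (ℓ : Vec m → Vec d → ℝ) (μ : LocMap d m) (z : Vec m) (θ : Vec d) : Vec d :=
  ContinuousLinearMap.adjoint (shiftMap μ) (∇ (jointLoss ℓ) (WithLp.toLp 2 (z + μ θ, θ)))

section

variable {d m : ℕ} {ℓ : Vec m → Vec d → ℝ} {R : ℝ} {β : ℝ≥0}

lemma hasGradientAt_plugIn (hs : IsJointlySmooth ℓ (closedBall (0 : Vec d) R) β) (μ : LocMap d m)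
    (z : Vec m) {θ : Vec d} (hθ : θ ∈ closedBall (0 : Vec d) R) :
    HasGradientAt (fun t => ℓ (z + μ t) t) (plugInGrad ℓ μ z θ) θ := by
  have e : ∀ t, (WithLp.toLp 2 (z + μ t, t) : WithLp 2 (Vec m × Vec d))
      = dataIncl d m z + shiftMap μ t := fun t => by
    rw [dataIncl_apply, shiftMap_apply, ← WithLp.toLp_add 2 (z, (0 : Vec d)) (μ t, t),
      Prod.mk_add_mk, zero_add]
  have hd : DifferentiableAt ℝ (jointLoss ℓ) (dataIncl d m z + shiftMap μ θ) := by
    rw [← e]; exact hs.1 _ hθ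
  have h := hasGradientAt_comp_affine (shiftMap μ) (dataIncl d m z) θ hd
  simp_rw [← e] at h
  exact h

lemma gradient_data (hs : IsJointlySmooth ℓ (closedBall (0 : Vec d) R) β) (z : Vec m) {θ : Vec d}
    (hθ : θ ∈ closedBall (0 : Vec d) R) : ∇ (fun w => ℓ w θ) z
      = ContinuousLinearMap.adjoint (dataIncl d m) (∇ (jointLoss ℓ) (WithLp.toLp 2 (z, θ))) := by
  have e : ∀ w, (WithLp.toLp 2 (w, θ) : WithLp 2 (Vec m × Vec d))
      = WithLp.toLp 2 (0, θ) + dataIncl d m w := fun w => by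
    rw [dataIncl_apply, ← WithLp.toLp_add, Prod.mk_add_mk, zero_add, add_zero]
  have hd : DifferentiableAt ℝ (jointLoss ℓ) (WithLp.toLp 2 (0, θ) + dataIncl d m z) := by
    rw [← e]; exact hs.1 _ hθ
  have h := hasGradientAt_comp_affine (dataIncl d m) (WithLp.toLp 2 (0, θ)) z hd
  simp_rw [← e] at h
  exact h.gradient

lemma norm_jointGrad_sub_le (hs : IsJointlySmooth ℓ (closedBall (0 : Vec d) R) β)
    {p q : WithLp 2 (Vec m × Vec d)} (hp : p.snd ∈ closedBall (0 : Vec d) R)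
    (hq : q.snd ∈ closedBall (0 : Vec d) R) :
    ‖∇ (jointLoss ℓ) p - ∇ (jointLoss ℓ) q‖ ≤ β * ‖p - q‖ := by
  have := hs.2.dist_le_mul p hp q hq
  rwa [dist_eq_norm, dist_eq_norm] at this

/-- The full gradient is bounded. The Lipschitz constants bound it where `θ` is the centre of the
ball; the smoothness carries the bound to the rest of the ball, its boundary included. -/
lemma norm_jointGrad_le {Lz L : ℝ≥0} (hR : 0 < R)
    (hLz : ∀ θ ∈ closedBall (0 : Vec d) R, LipschitzWith Lz (fun z => ℓ z θ))
    (hL : ∀ z, LipschitzOnWith L (fun θ => ℓ z θ) (closedBall (0 : Vec d) R))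
    (hs : IsJointlySmooth ℓ (closedBall (0 : Vec d) R) β)
    {p : WithLp 2 (Vec m × Vec d)} (hp : p.snd ∈ closedBall (0 : Vec d) R) :
    ‖∇ (jointLoss ℓ) p‖ ≤ Lz + L + β * R := by
  set q : WithLp 2 (Vec m × Vec d) := WithLp.toLp 2 (p.fst, 0) with hq
  have hq0 : q.snd = 0 := rfl
  have hqS : q.snd ∈ closedBall (0 : Vec d) R := by rw [hq0]; simp [hR.le]
  have hnhds : {p : WithLp 2 (Vec m × Vec d) | p.snd ∈ closedBall (0 : Vec d) R} ∈ nhds q := by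
    have hc : ContinuousAt (fun p : WithLp 2 (Vec m × Vec d) => p.snd) q := by fun_prop
    exact hc (show closedBall (0 : Vec d) R ∈ nhds q.snd by
      rw [hq0]; exact closedBall_mem_nhds _ hR)
  have hlip : LipschitzOnWith (Lz + L) (jointLoss ℓ)
      {p : WithLp 2 (Vec m × Vec d) | p.snd ∈ closedBall (0 : Vec d) R} := by
    refine LipschitzOnWith.of_dist_le_mul fun x hx y hy => ?_
    have h1 := (hLz _ hx).dist_le_mul x.fst y.fst
    have h2 := (hL y.fst).dist_le_mul _ hx _ hy
    have h3 : dist x.fst y.fst ≤ dist x y := by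
      rw [dist_eq_norm, dist_eq_norm]; exact norm_fst_le (x - y)
    have h4 : dist x.snd y.snd ≤ dist x y := by
      rw [dist_eq_norm, dist_eq_norm]; exact norm_snd_le (x - y)
    calc dist (jointLoss ℓ x) (jointLoss ℓ y)
        ≤ dist (ℓ x.fst x.snd) (ℓ y.fst x.snd) + dist (ℓ y.fst x.snd) (ℓ y.fst y.snd) :=
          dist_triangle _ _ _
      _ ≤ Lz * dist x y + L * dist x y :=
          add_le_add (h1.trans (by gcongr)) (h2.trans (by gcongr))
      _ = _ := by push_cast; ring
  have h0 : ‖∇ (jointLoss ℓ) q‖ ≤ Lz + L := by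
    have := norm_fderiv_le_of_lipschitzOn ℝ hnhds hlip
    rw [gradient, LinearIsometryEquiv.norm_map]
    exact_mod_cast this
  have h1 := norm_jointGrad_sub_le hs hp hqS
  have h2 : ‖p - q‖ = ‖p.snd‖ := by
    have : p - q = WithLp.toLp 2 (0, p.snd) := by
      change WithLp.toLp 2 (p.fst, p.snd) - WithLp.toLp 2 (p.fst, (0 : Vec d)) = _
      rw [← WithLp.toLp_sub, Prod.mk_sub_mk, sub_self, sub_zero]
    rw [this, norm_toLp_zero_left]
  have h3 : ‖p.snd‖ ≤ R := by simpa using hp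
  calc ‖∇ (jointLoss ℓ) p‖ = ‖∇ (jointLoss ℓ) q + (∇ (jointLoss ℓ) p - ∇ (jointLoss ℓ) q)‖ := by
        congr 1; abel
    _ ≤ ‖∇ (jointLoss ℓ) q‖ + ‖∇ (jointLoss ℓ) p - ∇ (jointLoss ℓ) q‖ := norm_add_le _ _
    _ ≤ (Lz + L) + β * R := add_le_add h0 (h1.trans (by rw [h2]; gcongr))

lemma norm_plugInGrad_le {B : ℝ}
    (hB : ∀ p : WithLp 2 (Vec m × Vec d), p.snd ∈ closedBall (0 : Vec d) R →
      ‖∇ (jointLoss ℓ) p‖ ≤ B) (μ : LocMap d m) (z : Vec m) {θ : Vec d}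
    (hθ : θ ∈ closedBall (0 : Vec d) R) : ‖plugInGrad ℓ μ z θ‖ ≤ (‖μ‖ + 1) * B := by
  refine (ContinuousLinearMap.le_opNorm _ _).trans ?_
  rw [(ContinuousLinearMap.adjoint (𝕜 := ℝ)).norm_map (shiftMap μ)]
  gcongr
  exacts [norm_shiftMap_le μ, hB _ hθ]

lemma norm_plugInGrad_sub_le (hs : IsJointlySmooth ℓ (closedBall (0 : Vec d) R) β)
    (μ : LocMap d m) (z : Vec m) {θ θ' : Vec d} (hθ : θ ∈ closedBall (0 : Vec d) R)
    (hθ' : θ' ∈ closedBall (0 : Vec d) R) :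
    ‖plugInGrad ℓ μ z θ - plugInGrad ℓ μ z θ'‖ ≤ β * (‖μ‖ + 1) ^ 2 * ‖θ - θ'‖ := by
  rw [plugInGrad, plugInGrad, ← map_sub]
  refine (ContinuousLinearMap.le_opNorm _ _).trans ?_
  rw [(ContinuousLinearMap.adjoint (𝕜 := ℝ)).norm_map (shiftMap μ)]
  have h1 := norm_jointGrad_sub_le hs (p := WithLp.toLp 2 (z + μ θ, θ))
    (q := WithLp.toLp 2 (z + μ θ', θ')) hθ hθ'
  have h2 : (WithLp.toLp 2 (z + μ θ, θ) : WithLp 2 (Vec m × Vec d))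
      - WithLp.toLp 2 (z + μ θ', θ') = shiftMap μ (θ - θ') := by
    rw [shiftMap_apply, ← WithLp.toLp_sub, Prod.mk_sub_mk, map_sub, add_sub_add_left_eq_sub]
  rw [h2] at h1
  have h3 := (shiftMap μ).le_of_opNorm_le (norm_shiftMap_le μ) (θ - θ')
  calc _ ≤ (‖μ‖ + 1) * (β * ((‖μ‖ + 1) * ‖θ - θ'‖)) := by
        gcongr
        exacts [norm_shiftMap_le μ, h1.trans (by gcongr)]
    _ = _ := by ring

/-- A mean value inequality on a convex set, in terms of gradients. -/
lemma abs_sub_le_of_norm_gradient_le {f : Vec d → ℝ} {g : Vec d → Vec d} {S : Set (Vec d)}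
    (hS : Convex ℝ S) (hf : ∀ x ∈ S, HasGradientAt f (g x) x) {C : ℝ} (hg : ∀ x ∈ S, ‖g x‖ ≤ C)
    {x y : Vec d} (hx : x ∈ S) (hy : y ∈ S) : |f y - f x| ≤ C * ‖y - x‖ :=
  hS.norm_image_sub_le_of_norm_hasFDerivWithin_le
    (fun t ht => (hf t ht).hasFDerivAt.hasFDerivWithinAt)
    (fun t ht => by rw [LinearIsometryEquiv.norm_map]; exact hg t ht) hx hy

lemma norm_shiftMap_sub_le (μ ν : LocMap d m) : ‖shiftMap ν - shiftMap μ‖ ≤ ‖ν - μ‖ := by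
  refine ContinuousLinearMap.opNorm_le_bound _ (norm_nonneg _) fun t => ?_
  have h : (shiftMap ν - shiftMap μ) t = dataIncl d m ((ν - μ) t) := by
    rw [sub_apply, shiftMap_apply, shiftMap_apply, dataIncl_apply,
      ← WithLp.toLp_sub 2 (ν t, t) (μ t, t), Prod.mk_sub_mk, sub_self, sub_apply]
  rw [h, norm_dataIncl_apply]
  exact (ν - μ).le_opNorm t

lemma norm_jointGrad_shift_sub_le (hs : IsJointlySmooth ℓ (closedBall (0 : Vec d) R) β)
    (μ ν : LocMap d m) (z : Vec m) {θ : Vec d} (hθ : θ ∈ closedBall (0 : Vec d) R) :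
    ‖∇ (jointLoss ℓ) (WithLp.toLp 2 (z + ν θ, θ)) - ∇ (jointLoss ℓ) (WithLp.toLp 2 (z + μ θ, θ))‖
      ≤ β * (‖ν - μ‖ * R) := by
  have hθR : ‖θ‖ ≤ R := by simpa using hθ
  refine (norm_jointGrad_sub_le hs (p := WithLp.toLp 2 (z + ν θ, θ))
    (q := WithLp.toLp 2 (z + μ θ, θ)) hθ hθ).trans ?_
  have h : (WithLp.toLp 2 (z + ν θ, θ) : WithLp 2 (Vec m × Vec d)) - WithLp.toLp 2 (z + μ θ, θ)
      = dataIncl d m ((ν - μ) θ) := by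
    rw [dataIncl_apply, ← WithLp.toLp_sub 2 (z + ν θ, θ) (z + μ θ, θ), Prod.mk_sub_mk, sub_self,
      add_sub_add_left_eq_sub, sub_apply]
  rw [h, norm_dataIncl_apply]
  gcongr
  exact (ContinuousLinearMap.le_opNorm _ _).trans (by gcongr)

lemma norm_plugInGrad_shift_sub_le (hs : IsJointlySmooth ℓ (closedBall (0 : Vec d) R) β) {B : ℝ}
    (hB : ∀ p : WithLp 2 (Vec m × Vec d), p.snd ∈ closedBall (0 : Vec d) R →
      ‖∇ (jointLoss ℓ) p‖ ≤ B) (μ ν : LocMap d m) (z : Vec m) {θ : Vec d}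
    (hθ : θ ∈ closedBall (0 : Vec d) R) :
    ‖plugInGrad ℓ ν z θ - plugInGrad ℓ μ z θ‖
      ≤ (B + (‖μ‖ + 1) * (β * R)) * ‖ν - μ‖ := by
  have hgrad := norm_jointGrad_shift_sub_le hs μ ν z hθ
  have hb := hB (WithLp.toLp 2 (z + ν θ, θ)) hθ
  rw [plugInGrad, plugInGrad]
  generalize ∇ (jointLoss ℓ) (WithLp.toLp 2 (z + ν θ, θ)) = g at *
  generalize ∇ (jointLoss ℓ) (WithLp.toLp 2 (z + μ θ, θ)) = g' at *
  have e : ContinuousLinearMap.adjoint (shiftMap ν) g - ContinuousLinearMap.adjoint (shiftMap μ) g'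
      = ContinuousLinearMap.adjoint (shiftMap ν - shiftMap μ) g
        + ContinuousLinearMap.adjoint (shiftMap μ) (g - g') := by
    rw [map_sub, map_sub, sub_apply]
    abel
  rw [e]
  refine (norm_add_le _ _).trans ?_
  have h1 : ‖ContinuousLinearMap.adjoint (shiftMap ν - shiftMap μ) g‖ ≤ ‖ν - μ‖ * B := by
    refine (ContinuousLinearMap.le_opNorm _ _).trans ?_
    rw [(ContinuousLinearMap.adjoint (𝕜 := ℝ)).norm_map]
    exact mul_le_mul (norm_shiftMap_sub_le μ ν) hb (norm_nonneg _) (norm_nonneg _)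
  have h2 : ‖ContinuousLinearMap.adjoint (shiftMap μ) (g - g')‖
      ≤ (‖μ‖ + 1) * (β * (‖ν - μ‖ * R)) := by
    refine (ContinuousLinearMap.le_opNorm _ _).trans ?_
    rw [(ContinuousLinearMap.adjoint (𝕜 := ℝ)).norm_map]
    exact mul_le_mul (norm_shiftMap_le μ) hgrad (norm_nonneg _) (by positivity)
  linarith

/-- Replacing the location map perturbs the increments of the plug-in loss by an amount
proportional to both the perturbation and the increment, for every single data point. -/
lemma abs_plugIn_increment_sub_le (hs : IsJointlySmooth ℓ (closedBall (0 : Vec d) R) β) {B : ℝ}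
    (hB : ∀ p : WithLp 2 (Vec m × Vec d), p.snd ∈ closedBall (0 : Vec d) R →
      ‖∇ (jointLoss ℓ) p‖ ≤ B) (μ ν : LocMap d m) (z : Vec m) {θ θ' : Vec d}
    (hθ : θ ∈ closedBall (0 : Vec d) R) (hθ' : θ' ∈ closedBall (0 : Vec d) R) :
    |(ℓ (z + ν θ) θ - ℓ (z + μ θ) θ) - (ℓ (z + ν θ') θ' - ℓ (z + μ θ') θ')|
      ≤ (B + (‖μ‖ + 1) * (β * R)) * ‖ν - μ‖ * ‖θ - θ'‖ := by
  refine abs_sub_le_of_norm_gradient_le (f := fun t => ℓ (z + ν t) t - ℓ (z + μ t) t)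
    (g := fun t => plugInGrad ℓ ν z t - plugInGrad ℓ μ z t)
    (convex_closedBall (0 : Vec d) R) (fun t ht => ?_)
    (fun t ht => norm_plugInGrad_shift_sub_le hs hB μ ν z ht) hθ' hθ
  rw [hasGradientAt_iff_hasFDerivAt, map_sub]
  exact (hasGradientAt_plugIn hs ν z ht).hasFDerivAt.sub
    (hasGradientAt_plugIn hs μ z ht).hasFDerivAt

/-- The remainder of the first-order expansion of the plug-in loss at `θ'` is Lipschitz on balls
around `θ'`, with a constant proportional to the radius. -/
lemma abs_remainder_sub_le (hs : IsJointlySmooth ℓ (closedBall (0 : Vec d) R) β)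
    (μ : LocMap d m) (z : Vec m) {θ' : Vec d} (hθ' : θ' ∈ closedBall (0 : Vec d) R) {ρ : ℝ}
    {x y : Vec d} (hx : x ∈ closedBall (0 : Vec d) R) (hxρ : ‖x - θ'‖ ≤ ρ)
    (hy : y ∈ closedBall (0 : Vec d) R) (hyρ : ‖y - θ'‖ ≤ ρ) :
    |(ℓ (z + μ y) y - ⟪plugInGrad ℓ μ z θ', y⟫) - (ℓ (z + μ x) x - ⟪plugInGrad ℓ μ z θ', x⟫)|
      ≤ β * (‖μ‖ + 1) ^ 2 * ρ * ‖y - x‖ := by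
  refine abs_sub_le_of_norm_gradient_le
    (f := fun t => ℓ (z + μ t) t - ⟪plugInGrad ℓ μ z θ', t⟫)
    (g := fun t => plugInGrad ℓ μ z t - plugInGrad ℓ μ z θ')
    ((convex_closedBall (0 : Vec d) R).inter (convex_closedBall θ' ρ)) (fun t ht => ?_)
    (fun t ht => ?_) ⟨hx, by rwa [mem_closedBall, dist_eq_norm]⟩
    ⟨hy, by rwa [mem_closedBall, dist_eq_norm]⟩
  · rw [hasGradientAt_iff_hasFDerivAt, map_sub]
    exact (hasGradientAt_plugIn hs μ z ht.1).hasFDerivAt.sub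
      (innerSL ℝ (plugInGrad ℓ μ z θ')).hasFDerivAt
  · refine (norm_plugInGrad_sub_le hs μ z ht.1 hθ').trans ?_
    have := ht.2
    rw [mem_closedBall, dist_eq_norm] at this
    gcongr

lemma continuous_jointGrad (hs : IsJointlySmooth ℓ (closedBall (0 : Vec d) R) β) {θ : Vec d}
    (hθ : θ ∈ closedBall (0 : Vec d) R) (w : Vec m) :
    Continuous fun z : Vec m => ∇ (jointLoss ℓ) (WithLp.toLp 2 (z + w, θ)) :=
  hs.2.continuousOn.comp_continuous (by fun_prop) fun _ => hθ

lemma continuous_plugInGrad (hs : IsJointlySmooth ℓ (closedBall (0 : Vec d) R) β) (μ : LocMap d m)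
    {θ : Vec d} (hθ : θ ∈ closedBall (0 : Vec d) R) : Continuous fun z => plugInGrad ℓ μ z θ :=
  (ContinuousLinearMap.continuous _).comp (continuous_jointGrad hs hθ _)

lemma continuousOn_plugIn (hs : IsJointlySmooth ℓ (closedBall (0 : Vec d) R) β) (μ : LocMap d m)
    (z : Vec m) : ContinuousOn (fun θ => ℓ (z + μ θ) θ) (closedBall (0 : Vec d) R) := fun _ hθ =>
  (hasGradientAt_plugIn hs μ z hθ).continuousAt.continuousWithinAt

/-- The algorithm has an output on all data. -/
lemma exists_isTwoStageOutput (hs : IsJointlySmooth ℓ (closedBall (0 : Vec d) R) β)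
    (hR : (closedBall (0 : Vec d) R).Nonempty) {n : ℕ} (x : Data d m n) :
    ∃ θhat, IsTwoStageOutput ℓ (closedBall (0 : Vec d) R) x θhat := by
  obtain ⟨μhat, hμ⟩ := exists_ols x.1
  obtain ⟨θhat, hθ, hmin⟩ := (isCompact_closedBall (0 : Vec d) R).exists_isMinOn hR
    (f := empiricalRisk ℓ x μhat) (continuousOn_const.mul
      (continuousOn_finsetSum _ fun j _ => continuousOn_plugIn hs μhat (x.2 j)))
  exact ⟨θhat, μhat, hμ, hθ, hmin⟩

end

/-! ### Strong convexity of the performative risk -/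

lemma IsSubgaussianVector.integrable_id {m : ℕ} {D₀ : Measure (Vec m)} [IsProbabilityMeasure D₀]
    {K : ℝ≥0} (hK : IsSubgaussianVector D₀ K) : Integrable (fun z => z) D₀ := by
  have e : (fun z : Vec m => z)
      = fun z => ∑ i, ⟪EuclideanSpace.basisFun (Fin m) ℝ i, z⟫
        • EuclideanSpace.basisFun (Fin m) ℝ i :=
    funext fun z => ((EuclideanSpace.basisFun (Fin m) ℝ).sum_repr' z).symm
  rw [e]
  exact integrable_finsetSum _ fun i _ =>
    ((hK _ ((EuclideanSpace.basisFun (Fin m) ℝ).norm_eq_one i)).integrable).smul_const _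

lemma integrable_lipschitz_comp_add {m : ℕ} {D₀ : Measure (Vec m)} [IsProbabilityMeasure D₀]
    (hint : Integrable (fun z => z) D₀) {f : Vec m → ℝ} {C : ℝ≥0} (hf : LipschitzWith C f)
    (w : Vec m) : Integrable (fun z => f (z + w)) D₀ := by
  refine Integrable.mono' ((hint.norm.const_mul (C : ℝ)).add (integrable_const ‖f w‖))
    (hf.continuous.comp (continuous_id.add continuous_const)).aestronglyMeasurable
    (Filter.Eventually.of_forall fun z => ?_)
  have h := hf.dist_le_mul (z + w) w
  rw [dist_eq_norm, dist_eq_norm, add_sub_cancel_right] at h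
  calc ‖f (z + w)‖ = ‖(f (z + w) - f w) + f w‖ := by rw [sub_add_cancel]
    _ ≤ ‖f (z + w) - f w‖ + ‖f w‖ := norm_add_le _ _
    _ ≤ C * ‖z‖ + ‖f w‖ := by gcongr

lemma locationFamily_apply {d m : ℕ} (D₀ : Measure (Vec m)) [IsProbabilityMeasure D₀]
    (μ : LocMap d m) (θ : Vec d) : locationFamily D₀ μ θ = D₀.map (fun z => z + μ θ) := rfl

lemma integral_locationFamily {d m : ℕ} {E : Type*} [NormedAddCommGroup E] [NormedSpace ℝ E]
    (D₀ : Measure (Vec m)) [IsProbabilityMeasure D₀] (μ : LocMap d m) (θ : Vec d) (f : Vec m → E) :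
    ∫ z, f z ∂(locationFamily D₀ μ θ) = ∫ z, f (z + μ θ) ∂D₀ :=
  (measurableEmbedding_addRight (μ θ)).integral_map f

lemma performativeRisk_eq {d m : ℕ} (D₀ : Measure (Vec m)) [IsProbabilityMeasure D₀]
    (μ : LocMap d m) (ℓ : Vec m → Vec d → ℝ) (θ : Vec d) :
    performativeRisk D₀ μ ℓ θ = ∫ z, ℓ (z + μ θ) θ ∂D₀ := integral_locationFamily _ _ _ _

/-- The distance of two members of a location family is at least the distance of their means. -/
lemma ofReal_norm_le_wasserstein1 {d m : ℕ} {D₀ : Measure (Vec m)} [IsProbabilityMeasure D₀]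
    (hint : Integrable (fun z => z) D₀) (μ : LocMap d m) (θ θ' : Vec d) :
    ENNReal.ofReal ‖μ (θ - θ')‖
      ≤ wasserstein1 (locationFamily D₀ μ θ) (locationFamily D₀ μ θ') := by
  refine le_iInf₂ fun π hπ => ?_
  obtain ⟨h1, h2⟩ := hπ
  have hloc : ∀ t, Integrable (fun z => z) (locationFamily D₀ μ t) := fun t => by
    rw [locationFamily_apply, (measurableEmbedding_addRight (μ t)).integrable_map_iff]
    exact hint.add (integrable_const (μ t))
  have hmean : ∀ t, ∫ z, z ∂(locationFamily D₀ μ t) = ∫ z, z ∂D₀ + μ t := fun t => by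
    rw [integral_locationFamily, integral_add hint (integrable_const _), integral_const]
    simp
  have i1 : Integrable (fun p : Vec m × Vec m => p.1) π := by
    have := hloc θ
    rw [← h1, integrable_map_measure (by fun_prop) (by fun_prop)] at this
    exact this
  have i2 : Integrable (fun p : Vec m × Vec m => p.2) π := by
    have := hloc θ'
    rw [← h2, integrable_map_measure (by fun_prop) (by fun_prop)] at this
    exact this
  have e1 : ∫ p, p.1 ∂π = ∫ z, z ∂D₀ + μ θ := by
    rw [← hmean θ, ← h1, integral_map (by fun_prop) (by fun_prop)]
  have e2 : ∫ p, p.2 ∂π = ∫ z, z ∂D₀ + μ θ' := by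
    rw [← hmean θ', ← h2, integral_map (by fun_prop) (by fun_prop)]
  have e3 : ∫ p, (p.1 - p.2) ∂π = μ (θ - θ') := by
    rw [integral_sub i1 i2, e1, e2, map_sub]
    abel
  rw [ofReal_norm, ← e3]
  refine (enorm_integral_le_lintegral_enorm _).trans (le_of_eq ?_)
  simp_rw [edist_eq_enorm_sub]

lemma sigmaMin_nonneg {d m : ℕ} (μ : LocMap d m) : 0 ≤ sigmaMin μ :=
  Real.sInf_nonneg (by rintro _ ⟨θ, _, rfl⟩; exact norm_nonneg _)

lemma sigmaMin_mul_norm_le {d m : ℕ} (μ : LocMap d m) (θ : Vec d) :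
    sigmaMin μ * ‖θ‖ ≤ ‖μ θ‖ := by
  rcases eq_or_ne θ 0 with rfl | hθ
  · simp
  have hn : 0 < ‖θ‖ := norm_pos_iff.2 hθ
  have h : sigmaMin μ ≤ ‖μ (‖θ‖⁻¹ • θ)‖ :=
    csInf_le ⟨0, by rintro _ ⟨θ, _, rfl⟩; exact norm_nonneg _⟩
      ⟨_, by simp [norm_smul, hn.ne'], rfl⟩
  rw [map_smul, norm_smul, norm_inv, norm_norm, inv_mul_eq_div, le_div_iff₀ hn] at h
  exact h

/-- The curvature available along a step of length `s` that moves the data by `q`. -/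
lemma convexityParameter_mul_le {γ γz ε β σ s q : ℝ} (hγz : 0 ≤ γz) (hβ : 0 ≤ β) (hσ : 0 ≤ σ)
    (hs : 0 ≤ s) (hqε : q ≤ ε * s) (hqσ : σ * s ≤ q) :
    convexityParameter γ γz ε β σ / 2 * s ^ 2
      ≤ γ / 2 * s ^ 2 + γz / 2 * q ^ 2 - β * s * q := by
  have h1 : (γ - 2 * ε * β + γz * σ ^ 2) / 2 * s ^ 2
      ≤ γ / 2 * s ^ 2 + γz / 2 * q ^ 2 - β * s * q := by
    have a1 : β * s * q ≤ β * s * (ε * s) := by gcongr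
    have a2 : γz * (σ * s) ^ 2 ≤ γz * q ^ 2 := by gcongr
    nlinarith
  rw [convexityParameter]
  split_ifs with h0
  · exact h1
  have hpos : 0 < γz := lt_of_le_of_ne hγz (Ne.symm h0)
  have h2 : (γ - β ^ 2 / γz) / 2 * s ^ 2
      ≤ γ / 2 * s ^ 2 + γz / 2 * q ^ 2 - β * s * q := by
    have : γ / 2 * s ^ 2 + γz / 2 * q ^ 2 - β * s * q - (γ - β ^ 2 / γz) / 2 * s ^ 2
        = (γz * q - β * s) ^ 2 / (2 * γz) := by
      field_simp
      ring
    have : 0 ≤ (γz * q - β * s) ^ 2 / (2 * γz) := by positivity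
    linarith
  rcases max_choice (γ - β ^ 2 / γz) (γ - 2 * ε * β + γz * σ ^ 2) with h | h <;> rw [h]
  exacts [h2, h1]

section

variable {d m : ℕ} {D₀ : Measure (Vec m)} [IsProbabilityMeasure D₀] {μ : LocMap d m}
  {ℓ : Vec m → Vec d → ℝ} {R : ℝ} {β : ℝ≥0}

/-- Moving the data from `D(θ')` to `D(θ)` while the loss is evaluated at `θ` changes the risk by
a first-order term in which only `θ'` appears, up to the mismatch `β s q`. -/
lemma integral_data_shift_ge (hint : Integrable (fun z => z) D₀) {Lz : ℝ≥0} {B γz : ℝ}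
    (hLz : ∀ θ ∈ closedBall (0 : Vec d) R, LipschitzWith Lz (fun z => ℓ z θ))
    (hs : IsJointlySmooth ℓ (closedBall (0 : Vec d) R) β)
    (hB : ∀ p : WithLp 2 (Vec m × Vec d), p.snd ∈ closedBall (0 : Vec d) R →
      ‖∇ (jointLoss ℓ) p‖ ≤ B)
    (hcz : IsStronglyConvexInData ℓ (closedBall (0 : Vec d) R)
      (dataSupport (locationFamily D₀ μ) (closedBall (0 : Vec d) R)) γz)
    {θ θ' : Vec d} (hθ : θ ∈ closedBall (0 : Vec d) R) (hθ' : θ' ∈ closedBall (0 : Vec d) R) :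
    ∫ z, ℓ (z + μ θ') θ ∂D₀
        + ⟪∫ z, ∇ (jointLoss ℓ) (WithLp.toLp 2 (z + μ θ', θ')) ∂D₀, dataIncl d m (μ (θ - θ'))⟫
        + γz / 2 * ‖μ (θ - θ')‖ ^ 2 - β * ‖θ - θ'‖ * ‖μ (θ - θ')‖
      ≤ ∫ z, ℓ (z + μ θ) θ ∂D₀ := by
  have hG : Integrable (fun z => ∇ (jointLoss ℓ) (WithLp.toLp 2 (z + μ θ', θ'))) D₀ :=
    Integrable.of_bound (continuous_jointGrad hs hθ' (μ θ')).aestronglyMeasurable B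
      (Filter.Eventually.of_forall fun z => hB _ hθ')
  have hsupp : ∀ t ∈ closedBall (0 : Vec d) R, ∀ᵐ z ∂D₀,
      z + μ t ∈ dataSupport (locationFamily D₀ μ) (closedBall (0 : Vec d) R) := fun t ht => by
    have h := Measure.support_mem_ae (μ := locationFamily D₀ μ t)
    rw [locationFamily_apply] at h
    filter_upwards [ae_of_ae_map (by fun_prop) h] with z hz
    exact mem_iUnion₂_of_mem ht hz
  have hi1 := integrable_lipschitz_comp_add hint (hLz θ hθ) (μ θ')
  have hi2 := hG.const_inner (𝕜 := ℝ) (dataIncl d m (μ (θ - θ')))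
  have hi3 := integrable_lipschitz_comp_add hint (hLz θ hθ) (μ θ)
  set c : ℝ := γz / 2 * ‖μ (θ - θ')‖ ^ 2 - β * ‖θ - θ'‖ * ‖μ (θ - θ')‖ with hc
  have hpt : ∀ᵐ z ∂D₀, ℓ (z + μ θ') θ + ⟪dataIncl d m (μ (θ - θ')),
      ∇ (jointLoss ℓ) (WithLp.toLp 2 (z + μ θ', θ'))⟫ + c ≤ ℓ (z + μ θ) θ := by
    filter_upwards [hsupp θ hθ, hsupp θ' hθ'] with z hz hz'
    have h := hcz θ hθ (z + μ θ) hz (z + μ θ') hz'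
    rw [gradient_data hs _ hθ, ContinuousLinearMap.adjoint_inner_left, add_sub_add_left_eq_sub,
      ← map_sub] at h
    have h1 := norm_jointGrad_sub_le hs (p := WithLp.toLp 2 (z + μ θ', θ'))
      (q := WithLp.toLp 2 (z + μ θ', θ)) hθ' hθ
    rw [← WithLp.toLp_sub 2 (z + μ θ', θ') (z + μ θ', θ), Prod.mk_sub_mk, sub_self,
      norm_toLp_zero_left, norm_sub_rev θ' θ] at h1
    generalize ∇ (jointLoss ℓ) (WithLp.toLp 2 (z + μ θ', θ)) = g at *
    generalize ∇ (jointLoss ℓ) (WithLp.toLp 2 (z + μ θ', θ')) = g' at *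
    have h2 : ⟪dataIncl d m (μ (θ - θ')), g' - g⟫ ≤ ‖μ (θ - θ')‖ * (β * ‖θ - θ'‖) := by
      refine (real_inner_le_norm _ _).trans ?_
      rw [norm_dataIncl_apply]
      gcongr
    rw [inner_sub_right, real_inner_comm g] at h2
    rw [hc]
    linarith
  have hI := integral_mono_ae ((hi1.add hi2).add (integrable_const c)) hi3 hpt
  simp only [Pi.add_apply] at hI
  rw [integral_add (by exact hi1.add hi2) (integrable_const c), integral_add hi1 hi2,
    integral_inner hG, integral_const, probReal_univ, one_smul, real_inner_comm] at hI
  rw [hc] at hI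
  linarith

/-- First-order strong convexity of the performative risk, with the assumptions of the setting. The
vector field `a` plays the role of the gradient; only the linearity of its pairing matters. -/
lemma exists_strong_convexity (hint : Integrable (fun z => z) D₀) {Lz : ℝ≥0} {B γ γz ε : ℝ}
    (hLz : ∀ θ ∈ closedBall (0 : Vec d) R, LipschitzWith Lz (fun z => ℓ z θ))
    (hs : IsJointlySmooth ℓ (closedBall (0 : Vec d) R) β)
    (hB : ∀ p : WithLp 2 (Vec m × Vec d), p.snd ∈ closedBall (0 : Vec d) R →
      ‖∇ (jointLoss ℓ) p‖ ≤ B)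
    (hcθ : IsStronglyConvexInParam (locationFamily D₀ μ) ℓ (closedBall (0 : Vec d) R) γ)
    (hγz : 0 ≤ γz)
    (hcz : IsStronglyConvexInData ℓ (closedBall (0 : Vec d) R)
      (dataSupport (locationFamily D₀ μ) (closedBall (0 : Vec d) R)) γz)
    (hε : 0 ≤ ε) (hsens : IsSensitive (locationFamily D₀ μ) (closedBall (0 : Vec d) R) ε) :
    ∃ a : Vec d → Vec d, ∀ θ ∈ closedBall (0 : Vec d) R, ∀ θ' ∈ closedBall (0 : Vec d) R,
      performativeRisk D₀ μ ℓ θ' + ⟪a θ', θ - θ'⟫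
        + convexityParameter γ γz ε β (sigmaMin μ) / 2 * ‖θ - θ'‖ ^ 2
        ≤ performativeRisk D₀ μ ℓ θ := by
  refine ⟨fun θ' => (∫ z, ∇ (fun t => ℓ z t) θ' ∂(locationFamily D₀ μ θ'))
    + ContinuousLinearMap.adjoint (dataIncl d m ∘L μ)
      (∫ z, ∇ (jointLoss ℓ) (WithLp.toLp 2 (z + μ θ', θ')) ∂D₀), fun θ hθ θ' hθ' => ?_⟩
  have h1 := integral_data_shift_ge hint hLz hs hB hcz hθ hθ'
  have h2 := hcθ θ hθ θ' hθ' θ' hθ'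
  rw [integral_locationFamily D₀ μ θ' (fun z => ℓ z θ'),
    integral_locationFamily D₀ μ θ' (fun z => ℓ z θ)] at h2
  have hqε : ‖μ (θ - θ')‖ ≤ ε * ‖θ - θ'‖ :=
    (ENNReal.ofReal_le_ofReal_iff (by positivity)).1
      ((ofReal_norm_le_wasserstein1 hint μ θ θ').trans (hsens θ hθ θ' hθ'))
  have h3 := convexityParameter_mul_le (γ := γ) hγz β.coe_nonneg (sigmaMin_nonneg μ)
    (norm_nonneg (θ - θ'))
    hqε (sigmaMin_mul_norm_le μ (θ - θ'))
  beta_reduce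
  rw [performativeRisk_eq, performativeRisk_eq, inner_add_left,
    ContinuousLinearMap.adjoint_inner_left, ContinuousLinearMap.comp_apply]
  linarith

end

/-- Quadratic growth at a minimizer. The first-order inequalities at the midpoint, towards both
ends of the segment, are added up, so that the linear terms cancel. -/
lemma quadratic_growth_of_strong_convexity {d : ℕ} {f : Vec d → ℝ} {a : Vec d → Vec d}
    {S : Set (Vec d)} {lam : ℝ} (hS : Convex ℝ S)
    (h : ∀ θ ∈ S, ∀ θ' ∈ S, f θ' + ⟪a θ', θ - θ'⟫ + lam / 2 * ‖θ - θ'‖ ^ 2 ≤ f θ)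
    {θ₀ : Vec d} (hθ₀ : θ₀ ∈ S) (hmin : IsMinOn f S θ₀) {θ : Vec d} (hθ : θ ∈ S) :
    lam / 4 * ‖θ - θ₀‖ ^ 2 ≤ f θ - f θ₀ := by
  set p : Vec d := midpoint ℝ θ θ₀ with hp
  have hpS : p ∈ S := hS.midpoint_mem hθ hθ₀
  have h1 := h θ hθ p hpS
  have h2 := h θ₀ hθ₀ p hpS
  have h3 : f θ₀ ≤ f p := hmin hpS
  have e1 : θ - p = (2⁻¹ : ℝ) • (θ - θ₀) := by
    rw [hp, left_sub_midpoint]; simp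
  have e2 : θ₀ - p = -((2⁻¹ : ℝ) • (θ - θ₀)) := by
    rw [hp, right_sub_midpoint, ← smul_neg, neg_sub]; simp
  rw [e1, norm_smul, mul_pow] at h1
  rw [e2, inner_neg_right, norm_neg, norm_smul, mul_pow] at h2
  norm_num at h1 h2
  linarith

/-! ### Uniform deviations over the parameter set -/

section

variable {Z : Type*} [MeasurableSpace Z] (P : Measure Z) [IsProbabilityMeasure P]

/-- The second moment of a sum of independent centred copies. -/
lemma integral_sq_sum_sub_le {n : ℕ} {X : Z → ℝ} (hX : Measurable X) {B : ℝ}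
    (hXB : ∀ z, |X z| ≤ B) :
    ∫ x, (∑ i, (∫ z, X z ∂P - X (x i))) ^ 2 ∂(Measure.pi fun _ : Fin n => P)
      ≤ n * ∫ z, X z ^ 2 ∂P := by
  have hint : Integrable X P := Integrable.of_bound hX.aestronglyMeasurable B
    (Filter.Eventually.of_forall hXB)
  have hmem : MemLp X 2 P := MemLp.of_bound hX.aestronglyMeasurable B
    (Filter.Eventually.of_forall hXB)
  set Y : Z → ℝ := fun z => ∫ z, X z ∂P - X z with hY
  have hYm : Measurable Y := measurable_const.sub hX
  have hYmem : MemLp Y 2 P := (memLp_const _).sub hmem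
  have hY0 : ∫ z, Y z ∂P = 0 := by
    rw [integral_sub (integrable_const _) hint, integral_const, probReal_univ, one_smul, sub_self]
  have hvarY : Var[Y; P] ≤ ∫ z, X z ^ 2 ∂P := by
    rw [variance_const_sub hX.aestronglyMeasurable]
    exact variance_le_expectation_sq hX.aestronglyMeasurable
  have hmeas : Measurable (∑ i, fun x : Fin n → Z => Y (x i)) := by
    rw [Finset.sum_fn]
    exact Finset.measurable_fun_sum _ fun i _ => hYm.comp (measurable_pi_apply i)
  have hmean : ∫ x, (∑ i, fun x : Fin n → Z => Y (x i)) x ∂(Measure.pi fun _ : Fin n => P) = 0 := by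
    simp only [Finset.sum_apply]
    rw [integral_finsetSum]
    · refine Finset.sum_eq_zero fun i _ => ?_
      rw [integral_comp_eval (μ := fun _ : Fin n => P) (f := Y) hYm.aestronglyMeasurable, hY0]
    · exact fun i _ => integrable_comp_eval (hYmem.integrable one_le_two)
  have h := variance_sum_pi (μ := fun _ : Fin n => P) (X := fun _ => Y) fun _ => hYmem
  rw [variance_of_integral_eq_zero hmeas.aemeasurable hmean] at h
  simp only [Finset.sum_apply, Finset.sum_const, Finset.card_univ, Fintype.card_fin,
    nsmul_eq_mul] at h
  rw [h]
  gcongr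

/-- The mean of independent bounded random vectors deviates by at most `O(1 / √(δ n))`, without any
dependence on the dimension, with probability `1 - δ`. -/
lemma measure_norm_sum_sub_le {d n : ℕ} {g : Z → Vec d} (hg : Measurable g) {B : ℝ} (hB0 : 0 < B)
    (hB : ∀ z, ‖g z‖ ≤ B) (hn : 0 < n) {δ : ℝ} (hδ : 0 < δ) :
    (Measure.pi fun _ : Fin n => P)
      {x | 2 * B * √(n / δ) < ‖∑ i, (∫ z, g z ∂P - g (x i))‖} ≤ ENNReal.ofReal (δ / 4) := by
  set Q := Measure.pi fun _ : Fin n => P with hQ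
  have hgint : Integrable g P := Integrable.of_bound hg.aestronglyMeasurable B
    (Filter.Eventually.of_forall hB)
  have hgk : ∀ k, Measurable fun z => g z k := fun k => by fun_prop
  have hgkB : ∀ k z, |g z k| ≤ B := fun k z =>
    (PiLp.norm_apply_le (g z) k).trans (hB z)
  have hcoord : ∀ k, (∫ z, g z ∂P) k = ∫ z, g z k ∂P := fun k =>
    ((EuclideanSpace.proj (𝕜 := ℝ) k).integral_comp_comm hgint).symm
  have hsq : ∀ x : Fin n → Z, ‖∑ i, (∫ z, g z ∂P - g (x i))‖ ^ 2
      = ∑ k, (∑ i, (∫ z, g z k ∂P - g (x i) k)) ^ 2 := fun x => by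
    rw [EuclideanSpace.real_norm_sq_eq]
    refine Finset.sum_congr rfl fun k _ => ?_
    congr 1
    rw [WithLp.ofLp_sum, Finset.sum_apply]
    exact Finset.sum_congr rfl fun i _ => by rw [PiLp.sub_apply, hcoord]
  have hbound : ∀ k (x : Fin n → Z), |∑ i, (∫ z, g z k ∂P - g (x i) k)| ≤ n * (B + B) :=
    fun k x => by
    have h1 : ∀ i, |∫ z, g z k ∂P - g (x i) k| ≤ B + B := fun i => by
      refine (abs_sub _ _).trans (add_le_add ?_ (hgkB k _))
      have := norm_integral_le_of_norm_le_const (μ := P) (f := fun z => g z k)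
        (Filter.Eventually.of_forall (hgkB k))
      simpa using this
    refine (Finset.abs_sum_le_sum_abs _ _).trans ((Finset.sum_le_sum fun i _ => h1 i).trans ?_)
    simp [mul_add]
  have hmeas : ∀ k, Measurable fun x : Fin n → Z => (∑ i, (∫ z, g z k ∂P - g (x i) k)) ^ 2 :=
    fun k => (Finset.measurable_fun_sum _ fun i _ =>
      measurable_const.sub ((hgk k).comp (measurable_pi_apply i))).pow_const 2
  have hint : ∀ k, Integrable (fun x : Fin n → Z => (∑ i, (∫ z, g z k ∂P - g (x i) k)) ^ 2) Q :=
    fun k => Integrable.of_bound (hmeas k).aestronglyMeasurable ((n * (B + B)) ^ 2)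
      (Filter.Eventually.of_forall fun x => by
        rw [Real.norm_eq_abs, abs_pow]
        exact pow_le_pow_left₀ (abs_nonneg _) (hbound k x) 2)
  have hE : ∫ x, ‖∑ i, (∫ z, g z ∂P - g (x i))‖ ^ 2 ∂Q ≤ n * B ^ 2 := by
    simp_rw [hsq]
    rw [integral_finsetSum _ fun k _ => hint k]
    calc ∑ k, ∫ x, (∑ i, (∫ z, g z k ∂P - g (x i) k)) ^ 2 ∂Q
        ≤ ∑ k, n * ∫ z, g z k ^ 2 ∂P :=
          Finset.sum_le_sum fun k _ => integral_sq_sum_sub_le P (hgk k) (hgkB k)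
      _ = n * ∫ z, ‖g z‖ ^ 2 ∂P := by
          rw [← Finset.mul_sum, ← integral_finsetSum]
          · simp_rw [EuclideanSpace.real_norm_sq_eq]
          · exact fun k _ => Integrable.of_bound ((hgk k).pow_const 2).aestronglyMeasurable (B ^ 2)
              (Filter.Eventually.of_forall fun z => by
                rw [Real.norm_eq_abs, abs_pow]
                exact pow_le_pow_left₀ (abs_nonneg _) (hgkB k z) 2)
      _ ≤ n * ∫ _z, B ^ 2 ∂P := by
          gcongr ?_ * ?_
          exact integral_mono_of_nonneg (Filter.Eventually.of_forall fun z => by positivity)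
            (integrable_const _) (Filter.Eventually.of_forall fun z =>
              pow_le_pow_left₀ (norm_nonneg _) (hB z) 2)
      _ = n * B ^ 2 := by simp
  have hint' : Integrable (fun x : Fin n → Z => ‖∑ i, (∫ z, g z ∂P - g (x i))‖ ^ 2) Q := by
    simp_rw [hsq]
    exact integrable_finsetSum _ fun k _ => hint k
  have hn' : (0 : ℝ) < n := by exact_mod_cast hn
  have hM := mul_meas_ge_le_integral_of_nonneg
    (Filter.Eventually.of_forall fun x => by positivity) hint' (4 * n * B ^ 2 / δ)
  have hM' : Q.real {x | 4 * n * B ^ 2 / δ ≤ ‖∑ i, (∫ z, g z ∂P - g (x i))‖ ^ 2} ≤ δ / 4 := by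
    have h1 := hM.trans hE
    have h2 : (0 : ℝ) < 4 * n * B ^ 2 / δ := by positivity
    rw [mul_comm, ← le_div_iff₀ h2] at h1
    refine h1.trans (le_of_eq ?_)
    field_simp
  refine (measure_mono fun x hx => ?_).trans
    ((ENNReal.le_ofReal_iff_toReal_le (measure_ne_top _ _) (by positivity)).2 hM')
  have hx' : 2 * B * √(n / δ) < ‖∑ i, (∫ z, g z ∂P - g (x i))‖ := hx
  change 4 * n * B ^ 2 / δ ≤ _
  calc 4 * n * B ^ 2 / δ = (2 * B * √(n / δ)) ^ 2 := by
        rw [mul_pow, Real.sq_sqrt (by positivity)]; ring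
    _ ≤ _ := pow_le_pow_left₀ (by positivity) hx'.le 2

end

lemma nat_mul_exp_neg_le {a : ℝ} (ha : 0 < a) (n : ℕ) :
    n * Real.exp (-(n * a)) ≤ 2 / a * Real.exp (-(n * a / 2)) := by
  have h1 : n * a / 2 ≤ Real.exp (n * a / 2) := by linarith [Real.add_one_le_exp (n * a / 2)]
  have h2 : Real.exp (-(n * a)) = Real.exp (-(n * a / 2)) * Real.exp (-(n * a / 2)) := by
    rw [← Real.exp_add]; ring_nf
  have h3 : (n : ℝ) ≤ 2 / a * Real.exp (n * a / 2) := by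
    rw [div_mul_eq_mul_div, le_div_iff₀ ha]; linarith
  calc n * Real.exp (-(n * a))
      ≤ 2 / a * Real.exp (n * a / 2) * (Real.exp (-(n * a / 2)) * Real.exp (-(n * a / 2))) := by
        rw [h2]; gcongr
    _ = 2 / a * Real.exp (-(n * a / 2)) * (Real.exp (n * a / 2) * Real.exp (-(n * a / 2))) := by
      ring
    _ = _ := by rw [← Real.exp_add, add_neg_cancel, Real.exp_zero, mul_one]

/-- The sample size that makes the union bound over `n` shells and `A ^ d` net points work. -/
lemma exists_sample_size {a A : ℝ} (ha : 0 < a) (hA : 1 ≤ A) :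
    ∃ c : ℝ, 0 < c ∧ ∀ (d n : ℕ) (δ : ℝ), 1 ≤ d → 0 < δ → δ < 1 →
      c * (d + Real.log (1 / δ)) ≤ n → n * (A ^ d * Real.exp (-(n * a))) ≤ δ / 4 := by
  have hlogA : 0 ≤ Real.log A := Real.log_nonneg hA
  refine ⟨2 / a * (|Real.log (8 / a)| + Real.log A + 1), by positivity,
    fun d n δ hd hδ hδ1 hn => ?_⟩
  have hlog : 0 < Real.log (1 / δ) := Real.log_pos (by rw [lt_div_iff₀ hδ]; linarith)
  have hd1 : (1 : ℝ) ≤ d := by exact_mod_cast hd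
  have hA0 : 0 < A := by linarith
  have h1 : Real.log (8 / a) + d * Real.log A + Real.log (1 / δ) ≤ n * a / 2 := by
    have e : n * a / 2 ≥ (|Real.log (8 / a)| + Real.log A + 1) * (d + Real.log (1 / δ)) := by
      have := mul_le_mul_of_nonneg_right hn (by positivity : 0 ≤ a / 2)
      calc (|Real.log (8 / a)| + Real.log A + 1) * (d + Real.log (1 / δ))
          = 2 / a * (|Real.log (8 / a)| + Real.log A + 1) * (d + Real.log (1 / δ)) * (a / 2) := by
            field_simp
        _ ≤ n * (a / 2) := this
        _ = n * a / 2 := by ring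
    have h2 : |Real.log (8 / a)| * 1 ≤ |Real.log (8 / a)| * (d + Real.log (1 / δ)) := by
      gcongr; linarith
    have h3 : 0 ≤ Real.log A * Real.log (1 / δ) := by positivity
    have h4 := le_abs_self (Real.log (8 / a))
    nlinarith
  calc n * (A ^ d * Real.exp (-(n * a))) = A ^ d * (n * Real.exp (-(n * a))) := by ring
    _ ≤ A ^ d * (2 / a * Real.exp (-(n * a / 2))) := by
        gcongr A ^ d * ?_
        exact nat_mul_exp_neg_le ha n
    _ ≤ A ^ d * (2 / a * Real.exp (-(Real.log (8 / a) + d * Real.log A + Real.log (1 / δ)))) := by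
        gcongr
    _ = δ / 4 := by
        rw [neg_add, neg_add, Real.exp_add, Real.exp_add, Real.exp_neg (Real.log (8 / a)),
          Real.exp_log (by positivity), Real.exp_neg (d * Real.log A), Real.exp_nat_mul,
          Real.exp_log hA0, Real.exp_neg (Real.log (1 / δ)), Real.exp_log (by positivity)]
        field_simp
        norm_num

lemma exists_dyadic_shell {R r : ℝ} {n : ℕ} (h0 : r ≤ 2 * R) (hn : 2 * R * (1 / 2) ^ n < r) :
    ∃ k < n, r ≤ 2 * R * (1 / 2) ^ k ∧ 2 * R * (1 / 2) ^ k < 2 * r := by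
  by_contra! h
  have : ∀ k ≤ n, r ≤ 2 * R * (1 / 2) ^ k := fun k => by
    induction k with
    | zero => intro _; simpa using h0
    | succ k ih =>
      intro hk
      have := h k (by omega) (ih (by omega))
      rw [pow_succ]
      linarith
  linarith [this n le_rfl]

/-- A family of functions of a sample point and a parameter, vanishing to second order at `θ₀`:
it vanishes there, and on balls around `θ₀` it is Lipschitz with constant proportional to the
radius. -/
structure IsQuadraticRemainder {Z : Type*} [MeasurableSpace Z] {d : ℕ} (h : Z → Vec d → ℝ)
    (S : Set (Vec d)) (θ₀ : Vec d) (b : ℝ) : Prop where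
  measurable : ∀ θ ∈ S, Measurable fun z => h z θ
  map_center : ∀ z, h z θ₀ = 0
  abs_sub_le : ∀ z, ∀ x ∈ S, ∀ y ∈ S, ∀ ρ, ‖x - θ₀‖ ≤ ρ → ‖y - θ₀‖ ≤ ρ →
    |h z y - h z x| ≤ b * ρ * ‖y - x‖

/-- Uniform deviation of a quadratic remainder, relative to the squared distance to the centre.
The parameter set is cut into dyadic shells; at the scale of its shell, the remainder is bounded and
Lipschitz with constants that do not depend on the shell, so that on every shell a net with
exponentially many points and Hoeffding's inequality suffice. On the innermost ball, of radius
`2 R 2⁻ⁿ`, the remainder is so small that no probability is needed. -/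
lemma exists_uniform_remainder_bound {b κ R : ℝ} (hb : 0 < b) (hκ : 0 < κ) (hR : 0 < R) :
    ∃ c : ℝ, 0 < c ∧ ∀ {Z : Type*} [MeasurableSpace Z] (P : Measure Z) [IsProbabilityMeasure P]
      {d n : ℕ} {h : Z → Vec d → ℝ} {S : Set (Vec d)} {θ₀ : Vec d} {δ : ℝ},
      S ⊆ closedBall 0 R → θ₀ ∈ S → IsQuadraticRemainder h S θ₀ b → 1 ≤ d → 0 < δ → δ < 1 →
      c * (d + Real.log (1 / δ)) ≤ n →
      (Measure.pi fun _ : Fin n => P) {x | ∃ θ ∈ S, n * (κ * ‖θ - θ₀‖ ^ 2) + 8 * b * R ^ 2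
        < ∑ i, (∫ z, h z θ ∂P - h (x i) θ)} ≤ ENNReal.ofReal (δ / 4) := by
  -- the deviation at the net points, relative to `b` times the squared radius of the shell, and the
  -- resolution of the nets, relative to the radius: as the radius is at most twice the distance to
  -- `θ₀`, they contribute `4 * (τ + 2 * η) * b = κ`
  set τ : ℝ := κ / (8 * b) with hτ
  set η : ℝ := κ / (16 * b) with hη
  have hτ0 : 0 < τ := by positivity
  have hη0 : 0 < η := by positivity
  obtain ⟨c, hc, hsize⟩ := exists_sample_size (a := τ ^ 2 / 2) (A := 1 + 2 / η) (by positivity)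
    (by have : 0 < 2 / η := by positivity
        linarith)
  refine ⟨c, hc, ?_⟩
  intro Z _ P _ d n h S θ₀ δ hS hθ₀ hrem hd hδ hδ1 hn
  set Q := Measure.pi fun _ : Fin n => P with hQ
  obtain ⟨ρ, hρ⟩ : ∃ ρ : ℕ → ℝ, ∀ k, ρ k = 2 * R * (1 / 2) ^ k := ⟨_, fun _ => rfl⟩
  have hρ0 : ∀ k, 0 < ρ k := fun k => by rw [hρ]; positivity
  have hnet : ∀ k, ∃ T : Finset (Vec d), (∀ y ∈ T, y ∈ S ∩ closedBall θ₀ (ρ k)) ∧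
      (∀ y ∈ S ∩ closedBall θ₀ (ρ k), ∃ z ∈ T, ‖y - z‖ ≤ η * ρ k) ∧
      (T.card : ℝ) ≤ (1 + 2 / η) ^ d := fun k => exists_net (hρ0 k) hη0 inter_subset_right
  choose T hTS hTnet hTcard using hnet
  have habs : ∀ z, ∀ θ ∈ S, ∀ ρ, ‖θ - θ₀‖ ≤ ρ → |h z θ| ≤ b * ρ * ‖θ - θ₀‖ := fun z θ hθ ρ hρ => by
    have := hrem.abs_sub_le z θ₀ hθ₀ θ hθ ρ (by simpa using (norm_nonneg _).trans hρ) hρ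
    rwa [hrem.map_center, sub_zero] at this
  have hint : ∀ θ ∈ S, Integrable (fun z => h z θ) P := fun θ hθ =>
    Integrable.of_bound (hrem.measurable θ hθ).aestronglyMeasurable _
      (Filter.Eventually.of_forall fun z => habs z θ hθ _ le_rfl)
  let E : ℕ → Set (Fin n → Z) := fun k => {x | ∃ t ∈ T k, x ∈ {x : Fin n → Z |
    n * (τ * (b * ρ k ^ 2)) ≤ ∑ i, (∫ z, h z t ∂P - h (x i) t)}}
  have hE : ∀ k ∈ Finset.range n, Q (E k)
      ≤ ENNReal.ofReal ((1 + 2 / η) ^ d * Real.exp (-(n * (τ ^ 2 / 2)))) := fun k _ =>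
    measure_exists_mem_le Q (T k) _ (hTcard k) (Real.exp_pos _).le fun t ht => by
      obtain ⟨htS, htρ⟩ := hTS k t ht
      rw [mem_closedBall, dist_eq_norm] at htρ
      refine pi_mean_sub_ge_le P (hrem.measurable t htS) (by have := hρ0 k; positivity) hτ0.le
        fun z => (habs z t htS _ htρ).trans ?_
      rw [pow_two, ← mul_assoc]
      have := hρ0 k
      gcongr
  have hunion : Q {x | ∃ k ∈ Finset.range n, x ∈ E k} ≤ ENNReal.ofReal (δ / 4) :=
    (measure_exists_mem_le Q (Finset.range n) E (c := n) (by simp) (by positivity) hE).trans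
      (ENNReal.ofReal_le_ofReal (hsize d n δ hd hδ hδ1 hn))
  refine (measure_mono ?_).trans hunion
  rintro x ⟨θ, hθ, hlarge⟩
  by_contra hx
  have hgood : ∀ k < n, ∀ t ∈ T k,
      ∑ i, (∫ z, h z t ∂P - h (x i) t) < n * (τ * (b * ρ k ^ 2)) := fun k hk t ht =>
    not_le.1 fun hle => hx ⟨k, Finset.mem_range.2 hk, t, ht, hle⟩
  set r := ‖θ - θ₀‖ with hr
  have hr0 : 0 ≤ r := norm_nonneg _
  have hn0 : (0 : ℝ) ≤ n := Nat.cast_nonneg n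
  have hr2R : r ≤ 2 * R := by
    have h1 : ‖θ‖ ≤ R := by simpa using hS hθ
    have h2 : ‖θ₀‖ ≤ R := by simpa using hS hθ₀
    linarith [norm_sub_le θ θ₀]
  rcases le_or_gt r (ρ n) with hsmall | hbig
  · -- at distance `r ≤ 2 R 2⁻ⁿ` the deviation is at most `2 b r²` for every sample
    have h1 : ∑ i, (∫ z, h z θ ∂P - h (x i) θ) ≤ n * (2 * (b * r * r)) := by
      have hterm : ∀ i, ∫ z, h z θ ∂P - h (x i) θ ≤ 2 * (b * r * r) := fun i => by
        have a1 := habs (x i) θ hθ r le_rfl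
        have a2 : ∫ z, h z θ ∂P ≤ b * r * r := by
          have := integral_mono (hint θ hθ) (integrable_const (b * r * r))
            fun z => (le_abs_self _).trans (habs z θ hθ r le_rfl)
          simpa using this
        linarith [neg_abs_le (h (x i) θ)]
      refine (Finset.sum_le_sum fun i _ => hterm i).trans ?_
      simp
    have h2 : (n : ℝ) * r ^ 2 ≤ 4 * R ^ 2 := by
      have h3 : r ^ 2 ≤ ρ n ^ 2 := by gcongr
      have h4 : ρ n ^ 2 = 4 * R ^ 2 * (1 / 4) ^ n := by
        rw [hρ, mul_pow, ← pow_mul, mul_comm n 2, pow_mul]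
        norm_num
        ring
      have h5 : (n : ℝ) * (1 / 4) ^ n ≤ 1 := by
        rw [one_div, inv_pow, ← div_eq_mul_inv, div_le_one (by positivity)]
        exact_mod_cast (Nat.lt_pow_self (by norm_num : 1 < 4)).le
      calc (n : ℝ) * r ^ 2 ≤ n * (4 * R ^ 2 * (1 / 4) ^ n) := by rw [← h4]; gcongr
        _ = 4 * R ^ 2 * (n * (1 / 4) ^ n) := by ring
        _ ≤ 4 * R ^ 2 * 1 := by gcongr
        _ = _ := mul_one _
    have h3 : 0 ≤ n * (κ * r ^ 2) := by positivity
    nlinarith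
  · obtain ⟨k, hk, hrk, hkr⟩ := exists_dyadic_shell hr2R (hρ n ▸ hbig)
    rw [← hρ] at hrk hkr
    obtain ⟨t, ht, hθt⟩ := hTnet k θ ⟨hθ, by rwa [mem_closedBall, dist_eq_norm]⟩
    obtain ⟨htS, htρ⟩ := hTS k t ht
    rw [mem_closedBall, dist_eq_norm] at htρ
    have hclose : ∀ z, |h z θ - h z t| ≤ b * ρ k * (η * ρ k) := fun z =>
      (hrem.abs_sub_le z t htS θ hθ (ρ k) htρ hrk).trans (by have := hρ0 k; gcongr)
    have hmean : ∫ z, h z θ ∂P - ∫ z, h z t ∂P ≤ b * ρ k * (η * ρ k) := by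
      rw [← integral_sub (hint θ hθ) (hint t htS)]
      have := integral_mono ((hint θ hθ).sub (hint t htS)) (integrable_const (b * ρ k * (η * ρ k)))
        fun z => (le_abs_self _).trans (hclose z)
      simpa using this
    have hsum : ∑ i, (∫ z, h z θ ∂P - h (x i) θ)
        ≤ ∑ i, (∫ z, h z t ∂P - h (x i) t) + n * (2 * (b * ρ k * (η * ρ k))) := by
      have hterm : ∀ i, ∫ z, h z θ ∂P - h (x i) θ
          ≤ (∫ z, h z t ∂P - h (x i) t) + 2 * (b * ρ k * (η * ρ k)) := fun i => by
        linarith [neg_abs_le (h (x i) θ - h (x i) t), hclose (x i)]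
      refine (Finset.sum_le_sum fun i _ => hterm i).trans (le_of_eq ?_)
      simp [Finset.sum_add_distrib]
    have hk2 : κ / 4 * ρ k ^ 2 ≤ κ * r ^ 2 := by
      have h6 : ρ k ^ 2 ≤ (2 * r) ^ 2 := by have := hρ0 k; gcongr
      nlinarith
    have e : τ * (b * ρ k ^ 2) + 2 * (b * ρ k * (η * ρ k)) = κ / 4 * ρ k ^ 2 := by
      rw [hτ, hη]; field_simp; ring
    have h7 : n * (τ * (b * ρ k ^ 2)) + n * (2 * (b * ρ k * (η * ρ k))) ≤ n * (κ * r ^ 2) := by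
      rw [← mul_add, e]; gcongr
    have h8 : 0 ≤ 8 * b * R ^ 2 := by positivity
    linarith [hgood k hk t ht]

/-! ### Excess risk of the two-stage algorithm -/

section

variable {d m : ℕ} {D₀ : Measure (Vec m)} [IsProbabilityMeasure D₀] {μ : LocMap d m}
  {ℓ : Vec m → Vec d → ℝ} {R : ℝ} {β : ℝ≥0}

/-- The remainder of the first-order expansion at `θ₀` of the plug-in loss `θ ↦ ℓ (z + μ θ; θ)`. -/
def plugInRemainder (ℓ : Vec m → Vec d → ℝ) (μ : LocMap d m) (θ₀ : Vec d) (z : Vec m) (θ : Vec d) :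
    ℝ :=
  (ℓ (z + μ θ) θ - ⟪plugInGrad ℓ μ z θ₀, θ⟫) - (ℓ (z + μ θ₀) θ₀ - ⟪plugInGrad ℓ μ z θ₀, θ₀⟫)

lemma plugIn_sub_eq (μ : LocMap d m) (θ₀ θ : Vec d) (z : Vec m) :
    ℓ (z + μ θ) θ - ℓ (z + μ θ₀) θ₀
      = plugInRemainder ℓ μ θ₀ z θ + ⟪θ - θ₀, plugInGrad ℓ μ z θ₀⟫ := by
  rw [plugInRemainder, inner_sub_left, real_inner_comm (plugInGrad ℓ μ z θ₀) θ,
    real_inner_comm (plugInGrad ℓ μ z θ₀) θ₀]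
  ring

lemma isQuadraticRemainder_plugIn {Lz : ℝ≥0}
    (hLz : ∀ θ ∈ closedBall (0 : Vec d) R, LipschitzWith Lz (fun z => ℓ z θ))
    (hs : IsJointlySmooth ℓ (closedBall (0 : Vec d) R) β) (μ : LocMap d m) {b : ℝ}
    (hb : β * (‖μ‖ + 1) ^ 2 ≤ b) {θ₀ : Vec d} (hθ₀ : θ₀ ∈ closedBall (0 : Vec d) R) :
    IsQuadraticRemainder (plugInRemainder ℓ μ θ₀) (closedBall (0 : Vec d) R) θ₀ b where
  measurable θ hθ := by
    have h : ∀ t ∈ closedBall (0 : Vec d) R,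
        Continuous fun z => ℓ (z + μ t) t - ⟪plugInGrad ℓ μ z θ₀, t⟫ := fun t ht =>
      ((hLz t ht).continuous.comp (continuous_id.add continuous_const)).sub
        ((continuous_plugInGrad hs μ hθ₀).inner continuous_const)
    exact ((h θ hθ).sub (h θ₀ hθ₀)).measurable
  map_center z := sub_self _
  abs_sub_le z x hx y hy ρ hxρ hyρ := by
    have h := abs_remainder_sub_le hs μ z hθ₀ hx hxρ hy hyρ
    have hρ0 : 0 ≤ ρ := (norm_nonneg _).trans hxρ
    rw [plugInRemainder, plugInRemainder, sub_sub_sub_cancel_right]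
    exact h.trans (by gcongr)

/-- The basic inequality of the second stage. Since the output minimizes the empirical plug-in risk,
the excess risk is a sum of deviations of empirical means from their expectations, all of them
for the true location map, and of the cost of replacing the estimate of the location map by the
true one. -/
lemma mul_excess_le (hint : Integrable (fun z => z) D₀) {Lz : ℝ≥0} {B : ℝ}
    (hLz : ∀ θ ∈ closedBall (0 : Vec d) R, LipschitzWith Lz (fun z => ℓ z θ))
    (hs : IsJointlySmooth ℓ (closedBall (0 : Vec d) R) β)
    (hB : ∀ p : WithLp 2 (Vec m × Vec d), p.snd ∈ closedBall (0 : Vec d) R →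
      ‖∇ (jointLoss ℓ) p‖ ≤ B)
    {θ₀ θhat : Vec d} (hθ₀ : θ₀ ∈ closedBall (0 : Vec d) R)
    (hθ : θhat ∈ closedBall (0 : Vec d) R) {n : ℕ} (hn : 0 < n) (x : Data d m n) (μhat : LocMap d m)
    (hmin : IsMinOn (empiricalRisk ℓ x μhat) (closedBall (0 : Vec d) R) θhat) :
    n * (performativeRisk D₀ μ ℓ θhat - performativeRisk D₀ μ ℓ θ₀)
      ≤ ∑ i, (∫ z, plugInRemainder ℓ μ θ₀ z θhat ∂D₀ - plugInRemainder ℓ μ θ₀ (x.2 i) θhat)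
        + ‖∑ i, (∫ z, plugInGrad ℓ μ z θ₀ ∂D₀ - plugInGrad ℓ μ (x.2 i) θ₀)‖ * ‖θhat - θ₀‖
        + n * ((B + (‖μ‖ + 1) * (β * R)) * ‖μhat - μ‖ * ‖θhat - θ₀‖) := by
  have hn' : (0 : ℝ) < n := by exact_mod_cast hn
  have hg : Integrable (fun z => plugInGrad ℓ μ z θ₀) D₀ :=
    Integrable.of_bound (continuous_plugInGrad hs μ hθ₀).aestronglyMeasurable _
      (Filter.Eventually.of_forall fun z => norm_plugInGrad_le hB μ z hθ₀)
  have hf := integrable_lipschitz_comp_add hint (hLz θhat hθ) (μ θhat)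
  have hf₀ := integrable_lipschitz_comp_add hint (hLz θ₀ hθ₀) (μ θ₀)
  have hginner : Integrable (fun z => ⟪θhat - θ₀, plugInGrad ℓ μ z θ₀⟫) D₀ := hg.const_inner _
  have hh : Integrable (fun z => plugInRemainder ℓ μ θ₀ z θhat) D₀ := by
    refine ((hf.sub hf₀).sub hginner).congr (Filter.Eventually.of_forall fun z => ?_)
    simp only [Pi.sub_apply, plugIn_sub_eq μ θ₀ θhat z, add_sub_cancel_right]
  have hexc : performativeRisk D₀ μ ℓ θhat - performativeRisk D₀ μ ℓ θ₀
      = ∫ z, plugInRemainder ℓ μ θ₀ z θhat ∂D₀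
        + ⟪θhat - θ₀, ∫ z, plugInGrad ℓ μ z θ₀ ∂D₀⟫ := by
    rw [performativeRisk_eq, performativeRisk_eq, ← integral_sub hf hf₀, ← integral_inner hg,
      ← integral_add hh hginner]
    simp_rw [plugIn_sub_eq μ θ₀ θhat]
  have hemp : ∑ i, (ℓ (x.2 i + μhat θhat) θhat - ℓ (x.2 i + μhat θ₀) θ₀) ≤ 0 := by
    have h : empiricalRisk ℓ x μhat θhat ≤ empiricalRisk ℓ x μhat θ₀ := hmin hθ₀
    rw [empiricalRisk, empiricalRisk] at h
    have := le_of_mul_le_mul_left h (by positivity)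
    rw [Finset.sum_sub_distrib]
    linarith
  have htrue : ∑ i, (ℓ (x.2 i + μ θhat) θhat - ℓ (x.2 i + μ θ₀) θ₀)
      ≤ n * ((B + (‖μ‖ + 1) * (β * R)) * ‖μhat - μ‖ * ‖θhat - θ₀‖) := by
    have hterm : ∀ i, ℓ (x.2 i + μ θhat) θhat - ℓ (x.2 i + μ θ₀) θ₀
        ≤ (ℓ (x.2 i + μhat θhat) θhat - ℓ (x.2 i + μhat θ₀) θ₀)
          + (B + (‖μ‖ + 1) * (β * R)) * ‖μhat - μ‖ * ‖θhat - θ₀‖ := fun i => by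
      have h := abs_plugIn_increment_sub_le hs hB μ μhat (x.2 i) hθ hθ₀
      linarith [neg_abs_le ((ℓ (x.2 i + μhat θhat) θhat - ℓ (x.2 i + μ θhat) θhat)
        - (ℓ (x.2 i + μhat θ₀) θ₀ - ℓ (x.2 i + μ θ₀) θ₀))]
    refine (Finset.sum_le_sum fun i _ => hterm i).trans ?_
    rw [Finset.sum_add_distrib, Finset.sum_const, Finset.card_univ, Fintype.card_fin,
      nsmul_eq_mul]
    linarith
  have hinner : ⟪θhat - θ₀, ∑ i, (∫ z, plugInGrad ℓ μ z θ₀ ∂D₀ - plugInGrad ℓ μ (x.2 i) θ₀)⟫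
      ≤ ‖∑ i, (∫ z, plugInGrad ℓ μ z θ₀ ∂D₀ - plugInGrad ℓ μ (x.2 i) θ₀)‖ * ‖θhat - θ₀‖ :=
    (real_inner_le_norm _ _).trans (mul_comm _ _).le
  have hdec : n * (performativeRisk D₀ μ ℓ θhat - performativeRisk D₀ μ ℓ θ₀)
      = ∑ i, (∫ z, plugInRemainder ℓ μ θ₀ z θhat ∂D₀ - plugInRemainder ℓ μ θ₀ (x.2 i) θhat)
        + ⟪θhat - θ₀, ∑ i, (∫ z, plugInGrad ℓ μ z θ₀ ∂D₀ - plugInGrad ℓ μ (x.2 i) θ₀)⟫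
        + ∑ i, (ℓ (x.2 i + μ θhat) θhat - ℓ (x.2 i + μ θ₀) θ₀) := by
    rw [hexc, inner_sum, ← Finset.sum_add_distrib, ← Finset.sum_add_distrib]
    simp_rw [plugIn_sub_eq μ θ₀ θhat, inner_sub_right]
    rw [Finset.sum_congr rfl fun i _ => show _ = ∫ z, plugInRemainder ℓ μ θ₀ z θhat ∂D₀
      + ⟪θhat - θ₀, ∫ z, plugInGrad ℓ μ z θ₀ ∂D₀⟫ by ring]
    simp [mul_add]
  linarith

/-- A quadratic growth condition turns a bound that is linear in the distance `r` to the minimizer,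
up to small errors, into a fast rate. -/
lemma excess_le_of_growth {lam e r a b : ℝ} (hlam : 0 < lam) (hgrowth : lam / 4 * r ^ 2 ≤ e)
    (hle : e ≤ lam / 16 * r ^ 2 + b + a * r) : e ≤ 8 * a ^ 2 / lam + 2 * b := by
  have h1 : a * r ≤ lam / 16 * r ^ 2 + 4 * a ^ 2 / lam := by
    have e1 : lam / 16 * r ^ 2 + 4 * a ^ 2 / lam - a * r = (lam * r - 8 * a) ^ 2 / (16 * lam) := by
      field_simp
      ring
    have : 0 ≤ (lam * r - 8 * a) ^ 2 / (16 * lam) := by positivity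
    linarith
  have h2 : 8 * a ^ 2 / lam = 2 * (4 * a ^ 2 / lam) := by ring
  linarith

/-- The rate that results from the three kinds of deviation: of the remainder (`lam / 16 * r ^ 2`
and `b`), of the gradient (`G`) and of the location map (`H`). -/
lemma excess_le_rate {lam e r b G H R D δ n : ℝ} (hlam : 0 < lam)
    (hb : 0 ≤ b) (hn : 0 < n) (hδ : 0 < δ) (hδ1 : δ < 1) (hD : 0 ≤ D)
    (hgrowth : lam / 4 * r ^ 2 ≤ e)
    (hle : n * e ≤ n * (lam / 16 * r ^ 2) + 8 * b * R ^ 2 + 2 * G * √(n / δ) * r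
      + n * (H * √(D / n) * r)) :
    e ≤ (64 * G ^ 2 / lam + 16 * H ^ 2 / lam + 16 * b * R ^ 2) * (D / n + 1 / (δ * n)) := by
  set p := √(1 / (δ * n)) with hp
  set q := √(D / n) with hq
  have s1 : p ^ 2 = 1 / (δ * n) := Real.sq_sqrt (by positivity)
  have s2 : q ^ 2 = D / n := Real.sq_sqrt (by positivity)
  have hsqrt : √(n / δ) = n * p := by
    rw [hp, show n / δ = n ^ 2 * (1 / (δ * n)) by field_simp, Real.sqrt_mul (by positivity),
      Real.sqrt_sq hn.le]
  have hle' : e ≤ lam / 16 * r ^ 2 + 8 * b * R ^ 2 / n + (2 * G * p + H * q) * r := by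
    refine le_of_mul_le_mul_left ?_ hn
    have h : n * (8 * b * R ^ 2 / n) = 8 * b * R ^ 2 := mul_div_cancel₀ _ hn.ne'
    rw [hsqrt] at hle
    rw [mul_add, mul_add, h]
    linarith
  have hfast := excess_le_of_growth hlam hgrowth hle'
  have hsq : (2 * G * p + H * q) ^ 2 ≤ 8 * G ^ 2 * p ^ 2 + 2 * H ^ 2 * q ^ 2 := by
    linarith [sq_nonneg (2 * G * p - H * q)]
  have hδn : 1 / n ≤ p ^ 2 := by
    rw [s1]
    gcongr
    nlinarith
  rw [← s1, ← s2]
  have t1 : 8 * (2 * G * p + H * q) ^ 2 / lam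
      ≤ 8 * (8 * G ^ 2 * p ^ 2 + 2 * H ^ 2 * q ^ 2) / lam := by gcongr
  have t2 : 2 * (8 * b * R ^ 2 / n) ≤ 16 * b * R ^ 2 * p ^ 2 := by
    calc 2 * (8 * b * R ^ 2 / n) = 16 * b * R ^ 2 * (1 / n) := by ring
      _ ≤ _ := by gcongr
  have t3 : 8 * (8 * G ^ 2 * p ^ 2 + 2 * H ^ 2 * q ^ 2) / lam
      = 64 * G ^ 2 / lam * p ^ 2 + 16 * H ^ 2 / lam * q ^ 2 := by ring
  have p1 : 0 ≤ 64 * G ^ 2 / lam * q ^ 2 := by positivity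
  have p2 : 0 ≤ 16 * H ^ 2 / lam * p ^ 2 := by positivity
  have p3 : 0 ≤ 16 * b * R ^ 2 * q ^ 2 := by positivity
  linarith

end

lemma locationFamily_zero {d m : ℕ} (D₀ : Measure (Vec m)) [IsProbabilityMeasure D₀]
    (μ : LocMap d m) : locationFamily D₀ μ 0 = D₀ := by
  rw [locationFamily_apply, map_zero]
  simp

/-- The union bound for events that each concern only one of the two batches. -/
lemma dataLaw_locationFamily_le {d m n : ℕ} (D₀ : Measure (Vec m)) [IsProbabilityMeasure D₀]
    (μ : LocMap d m) {A : Set (Data d m n)} {E₁ : Set (Fin n → Vec d × Vec m)}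
    {E₂ E₃ : Set (Fin n → Vec m)} (hA : ∀ x ∈ A, x.1 ∈ E₁ ∨ x.2 ∈ E₂ ∨ x.2 ∈ E₃) :
    dataLaw (locationFamily D₀ μ) n A
      ≤ (Measure.pi fun _ : Fin n => (stdGaussian (Vec d)) ⊗ₘ (locationFamily D₀ μ)) E₁
        + ((Measure.pi fun _ : Fin n => D₀) E₂ + (Measure.pi fun _ : Fin n => D₀) E₃) := by
  have hsub : A ⊆ E₁ ×ˢ univ ∪ (univ ×ˢ E₂ ∪ univ ×ˢ E₃) := fun x hx => by
    rcases hA x hx with h | h | h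
    exacts [Or.inl ⟨h, mem_univ _⟩, Or.inr (Or.inl ⟨mem_univ _, h⟩),
      Or.inr (Or.inr ⟨mem_univ _, h⟩)]
  rw [dataLaw, locationFamily_zero]
  refine (measure_mono hsub).trans ((measure_union_le _ _).trans (add_le_add (le_of_eq ?_)
    ((measure_union_le _ _).trans (add_le_add (le_of_eq ?_) (le_of_eq ?_)))))
  all_goals rw [Measure.prod_prod, measure_univ]
  exacts [mul_one _, one_mul _, one_mul _]

/-- The bound on the excess risk in the non-degenerate case of a positive radius and dimension. -/
lemma exists_excess_bound (K Lz L β : ℝ≥0) (M : ℝ) {R lam : ℝ} (hR : 0 < R) (hlam : 0 < lam) :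
    ∃ c C : ℝ, 0 < c ∧ 0 < C ∧
      ∀ (d m : ℕ) (D₀ : Measure (Vec m)) [IsProbabilityMeasure D₀] (μ : LocMap d m)
        (ℓ : Vec m → Vec d → ℝ) (θ₀ : Vec d), 1 ≤ d → IsSubgaussianVector D₀ K → ‖μ‖ ≤ M →
        (∀ θ ∈ closedBall (0 : Vec d) R, LipschitzWith Lz (fun z => ℓ z θ)) →
        (∀ z, LipschitzOnWith L (fun θ => ℓ z θ) (closedBall (0 : Vec d) R)) →
        IsJointlySmooth ℓ (closedBall (0 : Vec d) R) β →
        θ₀ ∈ closedBall (0 : Vec d) R →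
        (∀ θ ∈ closedBall (0 : Vec d) R, lam / 4 * ‖θ - θ₀‖ ^ 2
          ≤ performativeRisk D₀ μ ℓ θ - performativeRisk D₀ μ ℓ θ₀) →
        ∀ (n : ℕ) (δ : ℝ), 0 < δ → δ < 1 → c * (d + m + Real.log (1 / δ)) ≤ n →
          dataLaw (locationFamily D₀ μ) n
            {x | ∃ θhat, IsTwoStageOutput ℓ (closedBall (0 : Vec d) R) x θhat ∧
              C * ((d + m + Real.log (1 / δ)) / n + 1 / (δ * n)) <
                performativeRisk D₀ μ ℓ θhat - performativeRisk D₀ μ ℓ θ₀}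
            ≤ ENNReal.ofReal δ := by
  -- bounds on the full gradient, on the plug-in gradient, on its Lipschitz constant, and on the
  -- effect of an error of the location map
  set B : ℝ := Lz + L + β * R with hBdef
  set G : ℝ := (|M| + 1) * B + 1 with hG
  set b : ℝ := β * (|M| + 1) ^ 2 + 1 with hb
  set H : ℝ := (B + (|M| + 1) * (β * R)) * (256 * (K + 1)) with hH
  have hB0 : 0 ≤ B := by positivity
  have hG0 : 0 < G := by positivity
  have hb0 : 0 < b := by positivity
  have hH0 : 0 ≤ H := by positivity
  obtain ⟨c, hc, hrem⟩ := exists_uniform_remainder_bound (κ := lam / 16) hb0 (by positivity) hR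
  refine ⟨c + 30, 64 * G ^ 2 / lam + 16 * H ^ 2 / lam + 16 * b * R ^ 2, by positivity,
    by positivity, ?_⟩
  intro d m D₀ _ μ ℓ θ₀ hd hK hμ hLz hL hs hθ₀ hgrowth n δ hδ hδ1 hn
  have hμM : ‖μ‖ ≤ |M| := hμ.trans (le_abs_self M)
  set D : ℝ := d + m + Real.log (1 / δ) with hD
  have hlog : 0 < Real.log (1 / δ) := Real.log_pos (by rw [lt_div_iff₀ hδ]; linarith)
  have hm0 : (0 : ℝ) ≤ m := Nat.cast_nonneg m
  have hd0 : (0 : ℝ) ≤ d := Nat.cast_nonneg d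
  have hD0 : 0 < D := by positivity
  have hn1 : 30 * D ≤ n := le_trans (by gcongr; linarith) hn
  have hn2 : c * (d + Real.log (1 / δ)) ≤ n :=
    le_trans (mul_le_mul (by linarith) (by linarith) (by positivity) (by positivity)) hn
  have hn0 : (0 : ℝ) < n := by linarith
  have hnpos : 0 < n := by exact_mod_cast hn0
  have hint := hK.integrable_id
  have hB : ∀ p : WithLp 2 (Vec m × Vec d), p.snd ∈ closedBall (0 : Vec d) R →
      ‖∇ (jointLoss ℓ) p‖ ≤ B := fun p hp => norm_jointGrad_le hR hLz hL hs hp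
  have hGz : ∀ z, ‖plugInGrad ℓ μ z θ₀‖ ≤ G := fun z =>
    (norm_plugInGrad_le hB μ z hθ₀).trans
      (le_trans (by gcongr) (le_add_of_nonneg_right zero_le_one))
  have hquad := isQuadraticRemainder_plugIn hLz hs μ
    (le_trans (by gcongr) (le_add_of_nonneg_right zero_le_one) : β * (‖μ‖ + 1) ^ 2 ≤ b) hθ₀
  have hE₁ := measure_ols_error_le hK μ hd hδ hδ1 hn1
  have hE₂ := hrem D₀ Subset.rfl hθ₀ hquad hd hδ hδ1 hn2
  have hE₃ := measure_norm_sum_sub_le D₀ (continuous_plugInGrad hs μ hθ₀).measurable hG0 hGz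
    hnpos hδ
  refine (dataLaw_locationFamily_le D₀ μ (fun x hx => ?_)).trans
    ((add_le_add hE₁ (add_le_add hE₂ hE₃)).trans (le_of_eq ?_))
  swap
  · rw [← ENNReal.ofReal_add, ← ENNReal.ofReal_add] <;> [congr 1; positivity; positivity;
      positivity; positivity]
    ring
  obtain ⟨θhat, ⟨μhat, hols, hθ, hmin⟩, hlarge⟩ := hx
  by_contra hgood
  simp only [not_or] at hgood
  obtain ⟨h1, h2, h3⟩ := hgood
  have h1' : ‖μhat - μ‖ ≤ 256 * (K + 1) * √(D / n) := not_lt.1 fun h => h1 ⟨μhat, hols, h⟩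
  have h2' : ∑ i, (∫ z, plugInRemainder ℓ μ θ₀ z θhat ∂D₀ - plugInRemainder ℓ μ θ₀ (x.2 i) θhat)
      ≤ n * (lam / 16 * ‖θhat - θ₀‖ ^ 2) + 8 * b * R ^ 2 := not_lt.1 fun h => h2 ⟨θhat, hθ, h⟩
  have h3' : ‖∑ i, (∫ z, plugInGrad ℓ μ z θ₀ ∂D₀ - plugInGrad ℓ μ (x.2 i) θ₀)‖
      ≤ 2 * G * √(n / δ) := not_lt.1 h3
  have hbasic := mul_excess_le (μ := μ) hint hLz hs hB hθ₀ hθ hnpos x μhat hmin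
  set e := performativeRisk D₀ μ ℓ θhat - performativeRisk D₀ μ ℓ θ₀ with he
  set r := ‖θhat - θ₀‖ with hr
  have hr0 : 0 ≤ r := norm_nonneg _
  have hshift : (B + (‖μ‖ + 1) * (β * R)) * ‖μhat - μ‖ * r ≤ H * √(D / n) * r := by
    rw [hH, mul_assoc (B + (|M| + 1) * (β * R))]
    gcongr
  have hfinal := excess_le_rate (G := G) (H := H) hlam hb0.le hn0 hδ hδ1 hD0.le (R := R)
    (hgrowth θhat hθ) (by
      have a1 := mul_le_mul_of_nonneg_right h3' hr0
      have a2 := mul_le_mul_of_nonneg_left hshift hn0.le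
      linarith)
  exact absurd hlarge (not_lt.2 hfinal)

end Performative

end

theorem mainTheorem3 (K Lz L β : ℝ≥0) (R M lam : ℝ) (hlam : 0 < lam) :
    ∃ c C : ℝ, 0 < c ∧ 0 < C ∧
      ∀ (d m : ℕ) (D₀ : Measure (Performative.Vec m)) [IsProbabilityMeasure D₀]
        (μ : Performative.LocMap d m) (ℓ : Performative.Vec m → Performative.Vec d → ℝ)
        (γ γz ε : ℝ) (θPO : Performative.Vec d),
        (∫ z, z ∂D₀) = 0 →
        Performative.IsSubgaussianVector D₀ K →
        ‖μ‖ ≤ M →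
        (∀ θ ∈ closedBall (0 : Performative.Vec d) R, LipschitzWith Lz (fun z => ℓ z θ)) →
        (∀ z, LipschitzOnWith L (fun θ => ℓ z θ) (closedBall (0 : Performative.Vec d) R)) →
        Performative.IsJointlySmooth ℓ (closedBall (0 : Performative.Vec d) R) β →
        Performative.IsStronglyConvexInParam (Performative.locationFamily D₀ μ) ℓ
          (closedBall (0 : Performative.Vec d) R) γ →
        0 ≤ γz →
        Performative.IsStronglyConvexInData ℓ (closedBall (0 : Performative.Vec d) R)
          (Performative.dataSupport (Performative.locationFamily D₀ μ)
            (closedBall (0 : Performative.Vec d) R)) γz →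
        0 ≤ ε →
        Performative.IsSensitive (Performative.locationFamily D₀ μ)
          (closedBall (0 : Performative.Vec d) R) ε →
        Performative.convexityParameter γ γz ε β (Performative.sigmaMin μ) = lam →
        θPO ∈ closedBall (0 : Performative.Vec d) R →
        IsMinOn (Performative.performativeRisk D₀ μ ℓ)
          (closedBall (0 : Performative.Vec d) R) θPO →
        ∀ (n : ℕ) (δ : ℝ), 0 < δ → δ < 1 →
          c * (d + m + Real.log (1 / δ)) ≤ n →
          Performative.HasInteriorPlugInMinimizer D₀ μ ℓ
            (closedBall (0 : Performative.Vec d) R) n →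
          (∀ x : Performative.Data d m n, ∃ θhat,
            Performative.IsTwoStageOutput ℓ (closedBall (0 : Performative.Vec d) R) x θhat) ∧
          Performative.dataLaw (Performative.locationFamily D₀ μ) n
            {x | ∃ θhat,
              Performative.IsTwoStageOutput ℓ (closedBall (0 : Performative.Vec d) R) x θhat ∧
              C * ((d + m + Real.log (1 / δ)) / n + 1 / (δ * n)) <
                Performative.performativeRisk D₀ μ ℓ θhat
                  - Performative.performativeRisk D₀ μ ℓ θPO}
            ≤ ENNReal.ofReal δ := by
  by_cases hR : 0 < R
  · obtain ⟨c, C, hc, hC, hbound⟩ := Performative.exists_excess_bound K Lz L β M hR hlam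
    refine ⟨c, C, hc, hC, ?_⟩
    intro d m D₀ _ μ ℓ γ γz ε θPO _ hK hμ hLz hL hs hcθ hγz hcz hε hsens hpar hPO hmin n δ hδ hδ1
      hn _
    refine ⟨fun x => Performative.exists_isTwoStageOutput hs ⟨θPO, hPO⟩ x, ?_⟩
    rcases Nat.eq_zero_or_pos d with rfl | hd
    · -- in dimension zero there is a single parameter
      have hlog : 0 < Real.log (1 / δ) := Real.log_pos (by rw [lt_div_iff₀ hδ]; linarith)
      refine (measure_mono_null (t := ∅) (fun x => ?_) measure_empty).trans_le zero_le
      rintro ⟨θhat, -, h⟩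
      rw [Subsingleton.elim θhat θPO, sub_self] at h
      exact absurd h (not_lt.2 (by positivity))
    · obtain ⟨a, ha⟩ := Performative.exists_strong_convexity hK.integrable_id hLz hs
        (fun p hp => Performative.norm_jointGrad_le hR hLz hL hs hp) hcθ hγz hcz hε hsens
      rw [hpar] at ha
      exact hbound d m D₀ μ ℓ θPO hd hK hμ hLz hL hs hPO
        (fun θ hθ => Performative.quadratic_growth_of_strong_convexity
          (convex_closedBall (0 : Performative.Vec d) R) ha hPO hmin hθ) n δ hδ hδ1 hn
  · -- a ball of radius zero has a single point, and a ball of negative radius has none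
    refine ⟨1, 1, one_pos, one_pos, ?_⟩
    intro d m D₀ _ μ ℓ γ γz ε θPO _ hK hμ hLz hL hs hcθ hγz hcz hε hsens hpar hPO hmin n δ hδ hδ1
      hn _
    refine ⟨fun x => Performative.exists_isTwoStageOutput hs ⟨θPO, hPO⟩ x, ?_⟩
    have hlog : 0 < Real.log (1 / δ) := Real.log_pos (by rw [lt_div_iff₀ hδ]; linarith)
    have hzero : ∀ θ ∈ closedBall (0 : Performative.Vec d) R, θ = 0 := fun θ hθ =>
      norm_le_zero_iff.1 ((mem_closedBall_zero_iff.1 hθ).trans (not_lt.1 hR))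
    refine (measure_mono_null (t := ∅) (fun x => ?_) measure_empty).trans_le zero_le
    rintro ⟨θhat, ⟨μhat, _, hθ, _⟩, h⟩
    rw [hzero θhat hθ, hzero θPO hPO, sub_self] at h
    exact absurd h (not_lt.2 (by positivity))
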